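/- Let $0<\alpha<1/2$ and let $L_2(\mathbb{R}_+;x^{2\alpha-1}dx)$ be the space of complex-valued functions on $\mathbb{R}_+=(0,\infty)$ with norm $\|f\|=\left(\int_0^\infty |f(x)|^2x^{2\alpha-1}dx\right)^{1/2}$. The half-Hilbert transform of $f$ is $(H_+f)(x)=\frac1\pi\,\mathrm{PV}\int_0^\infty \frac{f(t)}{t-x}\,dt$, $x>0$, whenever the principal value $\lim_{\varepsilon\to0+}\frac1\pi\int_{t>0,\,|t-x|>\varepsilon}\frac{f(t)}{t-x}\,dt$ exists; it exists for all $x>0$ if $f$ is three times continuously differentiable with compact support in $(0,\infty)$. Then $H_+$ extends from the class of these functions $f$ to a unique bounded operator $H_+:L_2(\mathbb{R}_+;x^{2\alpha-1}dx)\to L_2(\mathbb{R}_+;x^{2\alpha-1}dx)$. The operator $H_+$ is invertible with bounded inverse, and $(H_+f)(x)$ equals the principal value above for almost all $x>0$ whenever $f\in L_2(\mathbb{R}_+;x^{2\alpha-1}dx)$ and that principal value exists for almost all $x>0$. For every $f\in L_2(\mathbb{R}_+;x^{2\alpha-1}dx)$ and $h=H_+f$, the integrals in the following two formulas converge absolutely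 for every $x>0$, and for almost all $x>0$ the derivative exists and $$h(x)=-\frac1\pi\frac{d}{dx}\int_0^\infty\log\left|1-\frac xt\right|f(t)\,dt,$$ $$f(x)=\frac1\pi\int_0^\infty\frac{h(t)}{(\sqrt x+\sqrt t)\sqrt t}\,dt-(H_+h)(x).$$ Moreover, for every $f\in L_2(\mathbb{R}_+;x^{2\alpha-1}dx)$, $$\|f\|\le\|H_+f\|\le\cot(\pi\alpha)\,\|f\|\quad\text{if }0<\alpha\le\tfrac14,$$ $$\cot(\pi\alpha)\,\|f\|\le\|H_+f\|\le\|f\|\quad\text{if }\tfrac14\le\alpha<\tfrac12.$$ -/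

import Mathlib

open MeasureTheory Filter Topology Set

/-- The measure `x^(2α-1) dx` on `(0, ∞)`; the space `L₂(ℝ₊; x^(2α-1) dx)` of complex-valued
functions is `Lp ℂ 2 (halfMeasure α)`. -/
noncomputable def halfMeasure (α : ℝ) : Measure ℝ :=
  (volume.restrict (Ioi (0 : ℝ))).withDensity fun x => ENNReal.ofReal (x ^ (2 * α - 1))

/-- The half-Hilbert transform of `f` exists at `x`, as the principal value
`(1/π) PV ∫₀^∞ f(t)/(t-x) dt`, and has the value `y`. -/
def HasHalfHilbertAt (f : ℝ → ℂ) (x : ℝ) (y : ℂ) : Prop :=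
  (∀ ε : ℝ, 0 < ε →
    IntegrableOn (fun t : ℝ => f t / ((t - x : ℝ) : ℂ)) {t : ℝ | 0 < t ∧ ε < |t - x|}) ∧
  Tendsto
    (fun ε : ℝ => (1 / (Real.pi : ℂ)) *
      ∫ t in {t : ℝ | 0 < t ∧ ε < |t - x|}, f t / ((t - x : ℝ) : ℂ))
    (𝓝[>] (0 : ℝ)) (𝓝 y)

/-- The function `g` is the (principal value) half-Hilbert transform of `f` almost everywhere on
`(0, ∞)`. -/
def HasHalfHilbert (f g : ℝ → ℂ) : Prop :=
  ∀ᵐ x ∂(volume.restrict (Ioi (0 : ℝ))), HasHalfHilbertAt f x (g x)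

/-- Three times continuously differentiable functions with compact support in `(0, ∞)`. -/
structure IsCcThree (φ : ℝ → ℂ) : Prop where
  contDiff : ContDiff ℝ 3 φ
  hasCompactSupport : HasCompactSupport φ
  tsupport_subset : tsupport φ ⊆ Ioi (0 : ℝ)

/-!
The half-Hilbert transform commutes with dilations, so it is diagonalized by the Mellin transform.
In logarithmic coordinates `x = e^s`, the map `f ↦ e^(αs) f(e^s)` is unitary from
`L²(ℝ₊; x^(2α-1) dx)` onto `L²(ℝ)` (`logCoord`), and a kernel that is homogeneous of degree `-1`
becomes a convolution kernel, hence a Fourier multiplier (`mellinMul_eq_integral`). Formally the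
symbol of `(1/π) PV 1/(t-x)` is `cot (π(α - 2πiξ))`. The operator `halfHilbert` is *defined* as the
multiplier with this symbol, which is bounded and bounded away from zero because `0 < α < 1/2`; its
inverse is the multiplier with symbol `tan (π(α - 2πiξ))`.

* Norms: on the line `Re w = πα` one has `|cot w|² = (cos² πα + sinh² Im w)/(sin² πα + sinh² Im w)`,
  which lies between `1` and `cot² πα` (`norm_cot_mem_of_sin_le_cos`, `norm_cot_mem_of_cos_le_sin`).
* Agreement with principal values: the conjugate Poisson kernels `(1/π) (t-x)/((t-x)² + τ²x²)`,
  `τ > 0`, are integrable convolution kernels in logarithmic coordinates. Their symbols come from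
  analytic continuation in `ℓ` of `∫ e^(zr)/(1+e^(r+ℓ)) dr` (`integral_shifted_kernel`), which for
  `ℓ = 0` is Euler's integral `π / sin πz`; they are uniformly bounded and converge to the cotangent
  as `τ → 0`, so the operators converge strongly. The conjugate Poisson integrals are also averages
  of truncated Hilbert transforms, so they converge to the principal value wherever that exists
  (`HasHalfHilbertAt.tendsto_conjPoisson`). Comparing the two limits along a subsequence gives
  `halfHilbert_ae_eq_of_hasHalfHilbert`.
* Inversion: the kernel `(1/π)/((√x+√t)√t)` has symbol `2 / sin 2w`, again by Euler's integral, and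
  `(2 / sin 2w) cot w - cot² w = 1` (`halfHilbert_inversion`).
* Logarithmic representation: `-(1/π) ∫ log|1 - y/t| f(t) dt = ∫₀^y (H f)(t) dt`. For smooth
  compactly supported `f` this is integration by parts; both sides are continuous in `f`, because
  `log|1 - y/t|` is square integrable against the dual weight (`memLp_dual_log`), and such `f` are
  dense (`dense_isCcThree`). Lebesgue differentiation then gives the derivative almost everywhere.
-/

open scoped FourierTransform BoundedContinuousFunction ENNReal Convolution ContDiff

/-! ### Fourier multipliers on `L²(ℝ)` -/

lemma memLp_boundedContinuous_mul (m : ℝ →ᵇ ℂ) {F : ℝ → ℂ} (hF : MemLp F 2) :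
    MemLp (fun ξ => m ξ * F ξ) 2 :=
  hF.of_le_mul (c := ‖m‖) (m.continuous.aestronglyMeasurable.mul hF.1)
    (Eventually.of_forall fun ξ => by
      rw [norm_mul]
      exact mul_le_mul_of_nonneg_right (m.norm_coe_le_norm ξ) (norm_nonneg _))

/-- Multiplication by a bounded continuous function, as an operator on `L²(ℝ)`. -/
noncomputable def mulL2 (m : ℝ →ᵇ ℂ) :
    Lp ℂ 2 (volume : Measure ℝ) →L[ℂ] Lp ℂ 2 (volume : Measure ℝ) :=
  LinearMap.mkContinuous
    { toFun := fun F => (memLp_boundedContinuous_mul m (Lp.memLp F)).toLp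
      map_add' := fun F G => by
        ext1
        refine (MemLp.coeFn_toLp _).trans ?_
        filter_upwards [Lp.coeFn_add F G,
          Lp.coeFn_add (memLp_boundedContinuous_mul m (Lp.memLp F)).toLp
            (memLp_boundedContinuous_mul m (Lp.memLp G)).toLp,
          (memLp_boundedContinuous_mul m (Lp.memLp F)).coeFn_toLp,
          (memLp_boundedContinuous_mul m (Lp.memLp G)).coeFn_toLp] with ξ h1 h2 h3 h4
        rw [h2, h1, Pi.add_apply, Pi.add_apply, h3, h4, mul_add]
      map_smul' := fun c F => by
        ext1
        refine (MemLp.coeFn_toLp _).trans ?_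
        filter_upwards [Lp.coeFn_smul c F,
          Lp.coeFn_smul c (memLp_boundedContinuous_mul m (Lp.memLp F)).toLp,
          (memLp_boundedContinuous_mul m (Lp.memLp F)).coeFn_toLp] with ξ h1 h2 h3
        simp only [RingHom.id_apply]
        rw [h2, h1, Pi.smul_apply, Pi.smul_apply, h3, smul_eq_mul, smul_eq_mul]
        ring }
    ‖m‖ fun F => by
      refine Lp.norm_le_mul_norm_of_ae_le_mul ?_
      filter_upwards [(memLp_boundedContinuous_mul m (Lp.memLp F)).coeFn_toLp] with ξ h
      simp only [LinearMap.coe_mk, AddHom.coe_mk]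
      rw [h, norm_mul]
      exact mul_le_mul_of_nonneg_right (m.norm_coe_le_norm ξ) (norm_nonneg _)

lemma coeFn_mulL2 (m : ℝ →ᵇ ℂ) (F : Lp ℂ 2 (volume : Measure ℝ)) :
    mulL2 m F =ᵐ[volume] fun ξ => m ξ * F ξ :=
  (memLp_boundedContinuous_mul m (Lp.memLp F)).coeFn_toLp

/-- The Fourier multiplier on `L²(ℝ)` with symbol `m`. -/
noncomputable def fourierMul (m : ℝ →ᵇ ℂ) :
    Lp ℂ 2 (volume : Measure ℝ) →L[ℂ] Lp ℂ 2 (volume : Measure ℝ) :=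
  ((Lp.fourierTransformₗᵢ ℝ ℂ).symm.toContinuousLinearEquiv :
      Lp ℂ 2 (volume : Measure ℝ) →L[ℂ] Lp ℂ 2 (volume : Measure ℝ)) ∘L mulL2 m ∘L
    ((Lp.fourierTransformₗᵢ ℝ ℂ).toContinuousLinearEquiv :
      Lp ℂ 2 (volume : Measure ℝ) →L[ℂ] Lp ℂ 2 (volume : Measure ℝ))

lemma fourierMul_apply (m : ℝ →ᵇ ℂ) (F : Lp ℂ 2 (volume : Measure ℝ)) :
    fourierMul m F = 𝓕⁻ (mulL2 m (𝓕 F)) := rfl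

lemma mulL2_mul (m n : ℝ →ᵇ ℂ) (F : Lp ℂ 2 (volume : Measure ℝ)) :
    mulL2 (m * n) F = mulL2 m (mulL2 n F) := by
  ext1
  filter_upwards [coeFn_mulL2 (m * n) F, coeFn_mulL2 m (mulL2 n F), coeFn_mulL2 n F]
    with ξ h1 h2 h3
  rw [h1, h2, h3, BoundedContinuousFunction.mul_apply, mul_assoc]

lemma mulL2_sub (m n : ℝ →ᵇ ℂ) (F : Lp ℂ 2 (volume : Measure ℝ)) :
    mulL2 (m - n) F = mulL2 m F - mulL2 n F := by
  ext1
  filter_upwards [coeFn_mulL2 (m - n) F, coeFn_mulL2 m F, coeFn_mulL2 n F,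
    Lp.coeFn_sub (mulL2 m F) (mulL2 n F)] with ξ h1 h2 h3 h4
  rw [h4, Pi.sub_apply, h1, h2, h3, BoundedContinuousFunction.sub_apply, sub_mul]

lemma mulL2_one (F : Lp ℂ 2 (volume : Measure ℝ)) : mulL2 1 F = F := by
  ext1
  filter_upwards [coeFn_mulL2 1 F] with ξ h1
  rw [h1, BoundedContinuousFunction.coe_one, Pi.one_apply, one_mul]

lemma fourierMul_mul (m n : ℝ →ᵇ ℂ) (F : Lp ℂ 2 (volume : Measure ℝ)) :
    fourierMul (m * n) F = fourierMul m (fourierMul n F) := by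
  simp only [fourierMul_apply, FourierTransform.fourier_fourierInv_eq, mulL2_mul]

lemma fourierMul_sub (m n : ℝ →ᵇ ℂ) (F : Lp ℂ 2 (volume : Measure ℝ)) :
    fourierMul (m - n) F = fourierMul m F - fourierMul n F := by
  simp only [fourierMul_apply, mulL2_sub]
  exact map_sub (Lp.fourierTransformₗᵢ ℝ ℂ).symm _ _

lemma fourierMul_one (F : Lp ℂ 2 (volume : Measure ℝ)) : fourierMul 1 F = F := by
  simp only [fourierMul_apply, mulL2_one, FourierTransform.fourierInv_fourier_eq]

lemma norm_fourierMul (m : ℝ →ᵇ ℂ) (F : Lp ℂ 2 (volume : Measure ℝ)) :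
    ‖fourierMul m F‖ = ‖mulL2 m (𝓕 F)‖ :=
  (Lp.fourierTransformₗᵢ ℝ ℂ).symm.norm_map _

lemma norm_fourierMul_le (m : ℝ →ᵇ ℂ) {C : ℝ} (hm : ∀ ξ, ‖m ξ‖ ≤ C)
    (F : Lp ℂ 2 (volume : Measure ℝ)) : ‖fourierMul m F‖ ≤ C * ‖F‖ := by
  rw [norm_fourierMul, ← Lp.norm_fourier_eq F]
  refine Lp.norm_le_mul_norm_of_ae_le_mul ?_
  filter_upwards [coeFn_mulL2 m (𝓕 F)] with ξ h
  rw [h, norm_mul]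
  exact mul_le_mul_of_nonneg_right (hm ξ) (norm_nonneg _)

lemma le_norm_fourierMul (m : ℝ →ᵇ ℂ) {c : ℝ} (hc : 0 < c) (hm : ∀ ξ, c ≤ ‖m ξ‖)
    (F : Lp ℂ 2 (volume : Measure ℝ)) : c * ‖F‖ ≤ ‖fourierMul m F‖ := by
  rw [norm_fourierMul, ← Lp.norm_fourier_eq F, ← le_inv_mul_iff₀ hc]
  refine Lp.norm_le_mul_norm_of_ae_le_mul ?_
  filter_upwards [coeFn_mulL2 m (𝓕 F)] with ξ h
  rw [h, norm_mul, le_inv_mul_iff₀ hc]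
  exact mul_le_mul_of_nonneg_right (hm ξ) (norm_nonneg _)

lemma L2_norm_sq_eq_integral {X : Type*} {_ : MeasurableSpace X} {μ : Measure X}
    (F : Lp ℂ 2 μ) : ‖F‖ ^ 2 = ∫ x, ‖F x‖ ^ 2 ∂μ := by
  have h : (inner ℂ F F : ℂ) = ((‖F‖ ^ 2 : ℝ) : ℂ) := by
    rw [inner_self_eq_norm_sq_to_K]; norm_cast
  rw [L2.inner_def] at h
  have h2 : ∀ x, (inner ℂ (F x) (F x) : ℂ) = ((‖F x‖ ^ 2 : ℝ) : ℂ) := fun x => by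
    rw [inner_self_eq_norm_sq_to_K]; norm_cast
  simp_rw [h2] at h
  rw [integral_complex_ofReal] at h
  exact_mod_cast h.symm

/-- Fourier multipliers with uniformly bounded, pointwise convergent symbols converge strongly. -/
lemma tendsto_fourierMul {ι : Type*} {l : Filter ι} [l.IsCountablyGenerated]
    {m : ι → ℝ →ᵇ ℂ} {m₀ : ℝ →ᵇ ℂ} {C : ℝ}
    (hC : ∀ᶠ i in l, ∀ ξ, ‖m i ξ‖ ≤ C) (hm : ∀ ξ, Tendsto (fun i => m i ξ) l (𝓝 (m₀ ξ)))
    (F : Lp ℂ 2 (volume : Measure ℝ)) :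
    Tendsto (fun i => fourierMul (m i) F) l (𝓝 (fourierMul m₀ F)) := by
  have key : Tendsto (fun i => mulL2 (m i) (𝓕 F)) l (𝓝 (mulL2 m₀ (𝓕 F))) := by
    rw [tendsto_iff_norm_sub_tendsto_zero]
    set G : Lp ℂ 2 (volume : Measure ℝ) := 𝓕 F
    have hsq : ∀ i, ‖mulL2 (m i) G - mulL2 m₀ G‖ ^ 2 = ∫ ξ, ‖(m i ξ - m₀ ξ) * G ξ‖ ^ 2 := by
      intro i
      rw [← mulL2_sub, L2_norm_sq_eq_integral]
      refine integral_congr_ae ?_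
      filter_upwards [coeFn_mulL2 (m i - m₀) G] with ξ h
      rw [h, BoundedContinuousFunction.sub_apply]
    have hG : Integrable fun ξ => ‖G ξ‖ ^ 2 := (Lp.memLp G).integrable_norm_pow two_ne_zero
    have hlim : Tendsto (fun i => ∫ ξ, ‖(m i ξ - m₀ ξ) * G ξ‖ ^ 2) l (𝓝 (∫ _ : ℝ, (0 : ℝ))) := by
      refine tendsto_integral_filter_of_dominated_convergence
        (fun ξ => (C + ‖m₀‖) ^ 2 * ‖G ξ‖ ^ 2) ?_ ?_ (hG.const_mul _) ?_
      · refine Eventually.of_forall fun i => ?_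
        exact ((((m i).continuous.sub m₀.continuous).aestronglyMeasurable.mul
          (Lp.aestronglyMeasurable G)).norm.pow 2)
      · filter_upwards [hC] with i hi
        refine Eventually.of_forall fun ξ => ?_
        rw [norm_pow, norm_norm, norm_mul, mul_pow]
        gcongr
        exact (norm_sub_le _ _).trans (add_le_add (hi ξ) (m₀.norm_coe_le_norm ξ))
      · refine Eventually.of_forall fun ξ => ?_
        have : Tendsto (fun i => ‖(m i ξ - m₀ ξ) * G ξ‖ ^ 2) l
            (𝓝 (‖(m₀ ξ - m₀ ξ) * G ξ‖ ^ 2)) :=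
          ((((hm ξ).sub_const _).mul_const _).norm).pow 2
        simpa using this
    simp_rw [← hsq, integral_zero] at hlim
    have := hlim.sqrt
    simpa [Real.sqrt_sq (norm_nonneg _)] using this
  exact ((Lp.fourierTransformₗᵢ ℝ ℂ).symm.continuous.tendsto _).comp key

lemma integral_fourier_mul {f g : ℝ → ℂ} (hf : Integrable f) (hg : Integrable g) :
    ∫ ξ, 𝓕 f ξ * g ξ = ∫ x, f x * 𝓕 g x := by
  have h := VectorFourier.integral_fourierIntegral_smul_eq_flip (L := innerₗ ℝ)
    Real.continuous_fourierChar (by exact continuous_inner) hf hg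
  rw [flip_innerₗ] at h
  exact h

/-- On `L¹ ∩ L²` the inverse Fourier transform of `L²` is given by the Fourier integral. -/
lemma fourierInv_toLp_ae_eq {g : ℝ → ℂ} (hg1 : Integrable g) (hg2 : MemLp g 2) :
    ((𝓕⁻ (hg2.toLp g) : Lp ℂ 2 (volume : Measure ℝ)) : ℝ → ℂ) =ᵐ[volume] 𝓕⁻ g := by
  have hcont : Continuous (𝓕⁻ g) := by
    rw [Real.fourierInv_eq_fourier_comp_neg]
    exact VectorFourier.fourierIntegral_continuous Real.continuous_fourierChar
      (by exact continuous_inner) hg1.comp_neg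
  refine ae_eq_of_integral_contDiff_smul_eq
    ((Lp.memLp _).locallyIntegrable (by norm_num)) hcont.locallyIntegrable fun ψ hψ hψc => ?_
  have hc : HasCompactSupport fun x => (ψ x : ℂ) := hψc.comp_left Complex.ofReal_zero
  let Ψ : SchwartzMap ℝ ℂ := hc.toSchwartzMap (Complex.ofRealCLM.contDiff.comp hψ)
  have hΨ : ∀ x, Ψ x = (ψ x : ℂ) := fun x => rfl
  have h1 := congrArg (fun T : TemperedDistribution ℝ ℂ => T Ψ)
    (Lp.fourierInv_toTemperedDistribution_eq (hg2.toLp g))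
  simp only [TemperedDistribution.fourierInv_apply, Lp.toTemperedDistribution_apply] at h1
  have h2 : ∫ x, (𝓕⁻ Ψ) x • (hg2.toLp g) x = ∫ x, (𝓕⁻ Ψ) x • g x := by
    refine integral_congr_ae ?_
    filter_upwards [hg2.coeFn_toLp] with x hx
    rw [hx]
  have h3 : ∫ x, (𝓕⁻ Ψ) x • g x = ∫ x, Ψ x • 𝓕⁻ g x := by
    rw [SchwartzMap.fourierInv_coe, Real.fourierInv_eq_fourier_comp_neg g]
    simp_rw [Real.fourierInv_eq_fourier_neg, smul_eq_mul]
    rw [← integral_fourier_mul Ψ.integrable hg1.comp_neg,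
      ← integral_neg_eq_self (fun x => 𝓕 (⇑Ψ) x * g (-x))]
    simp
  exact h1.symm.trans (h2.trans h3)

lemma continuous_integral_mul_of_memLp_two {X : Type*} {_ : MeasurableSpace X} {μ : Measure X}
    {κ : X → ℂ} (hκ : MemLp κ 2 μ) : Continuous fun F : Lp ℂ 2 μ => ∫ x, κ x * F x ∂μ := by
  have h : ∀ F : Lp ℂ 2 μ, ∫ x, κ x * F x ∂μ = inner ℂ (hκ.star.toLp _) F := by
    intro F
    rw [L2.inner_def]
    refine integral_congr_ae ?_
    filter_upwards [hκ.star.coeFn_toLp] with x hx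
    rw [hx]
    simp [mul_comm]
  simp_rw [h]
  fun_prop

/-- If a continuous map into `L²` is given almost everywhere, on a dense set, by functionals that
depend continuously on the argument, then it is so everywhere. -/
lemma ae_eq_of_dense {X Y : Type*} [PseudoMetricSpace Y] {_ : MeasurableSpace X} {μ : Measure X}
    {T : Y → Lp ℂ 2 μ} (hT : Continuous T) {k : Y → X → ℂ}
    (hk : ∀ᵐ x ∂μ, Continuous fun y => k y x) {S : Set Y} (hS : Dense S)
    (h : ∀ y ∈ S, T y =ᵐ[μ] k y) (y : Y) : T y =ᵐ[μ] k y := by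
  obtain ⟨u, huS, hu⟩ := mem_closure_iff_seq_limit.1 (hS y)
  have h1 : Tendsto (fun n => T (u n)) atTop (𝓝 (T y)) := (hT.tendsto y).comp hu
  obtain ⟨ns, hns, hae⟩ := (tendstoInMeasure_of_tendsto_Lp h1).exists_seq_tendsto_ae
  have h2 : ∀ᵐ x ∂μ, ∀ n, T (u n) x = k (u n) x := ae_all_iff.2 fun n => h _ (huS n)
  filter_upwards [hae, h2, hk] with x hx1 hx2 hx3
  refine tendsto_nhds_unique hx1 ?_
  simp_rw [hx2]
  exact (hx3.tendsto y).comp (hu.comp hns.tendsto_atTop)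

/-- The Fourier multiplier whose symbol is the Fourier transform of `K` is convolution with `K`. -/
lemma fourierMul_eq_convolution {K : ℝ → ℂ} (hK1 : Integrable K) (hK2 : MemLp K 2) (m : ℝ →ᵇ ℂ)
    (hm : ∀ ξ, m ξ = 𝓕 K ξ) (F : Lp ℂ 2 (volume : Measure ℝ)) :
    fourierMul m F =ᵐ[volume] fun s => ∫ u, K (s - u) * F u := by
  refine ae_eq_of_dense (k := fun F s => ∫ u, K (s - u) * (F : ℝ → ℂ) u)
    (fourierMul m).continuous (Eventually.of_forall fun s => ?_)
    (SchwartzMap.denseRange_toLpCLM (E := ℝ) (F := ℂ) (p := 2) (μ := volume)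
      ENNReal.ofNat_ne_top) ?_ F
  · exact continuous_integral_mul_of_memLp_two
      (hK2.comp_measurePreserving (volume.measurePreserving_sub_left s))
  rintro _ ⟨φ, rfl⟩
  have hg1 : Integrable fun ξ => m ξ * (𝓕 φ : SchwartzMap ℝ ℂ) ξ :=
    ((𝓕 φ : SchwartzMap ℝ ℂ).integrable).bdd_mul (c := ‖m‖) m.continuous.aestronglyMeasurable
      (Eventually.of_forall m.norm_coe_le_norm)
  have hg2 : MemLp (fun ξ => m ξ * (𝓕 φ : SchwartzMap ℝ ℂ) ξ) 2 :=
    memLp_boundedContinuous_mul m ((𝓕 φ : SchwartzMap ℝ ℂ).memLp 2)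
  have h1 : fourierMul m (φ.toLp 2) = 𝓕⁻ (hg2.toLp _) := by
    rw [fourierMul_apply, SchwartzMap.toLp_fourier_eq]
    congr 1
    ext1
    filter_upwards [coeFn_mulL2 m ((𝓕 φ).toLp 2), hg2.coeFn_toLp, (𝓕 φ).coeFn_toLp 2 volume]
      with ξ e1 e2 e3
    rw [e1, e2, e3]
  rw [SchwartzMap.toLpCLM_apply, h1]
  filter_upwards [fourierInv_toLp_ae_eq hg1 hg2] with s hs
  rw [hs]
  have h2 : ∫ u, K (s - u) * (φ.toLp 2 : Lp ℂ 2 (volume : Measure ℝ)) u = ∫ u, K (s - u) * φ u := by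
    refine integral_congr_ae ?_
    filter_upwards [φ.coeFn_toLp 2 volume] with u hu
    rw [hu]
  rw [h2, ← integral_sub_left_eq_self (fun u => K (s - u) * φ u) volume s]
  simp only [sub_sub_cancel]
  have h3 : ∀ u, φ (s - u) =
      𝓕 (fun ξ => Complex.exp ((2 * Real.pi * (ξ * s) : ℝ) * Complex.I) * 𝓕 (⇑φ) ξ) u := by
    intro u
    have h4 : 𝓕⁻ (𝓕 φ : SchwartzMap ℝ ℂ) = φ := FourierTransform.fourierInv_fourier_eq φ
    conv_lhs => rw [← h4]
    rw [SchwartzMap.fourierInv_coe, SchwartzMap.fourier_coe, Real.fourierInv_eq',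
      Real.fourier_real_eq_integral_exp_smul]
    refine integral_congr_ae (Eventually.of_forall fun ξ => ?_)
    simp only [smul_eq_mul]
    rw [← mul_assoc, ← Complex.exp_add]
    congr 2
    simp
    ring
  simp_rw [h3]
  have h5 : Integrable fun ξ => Complex.exp ((2 * Real.pi * (ξ * s) : ℝ) * Complex.I) * 𝓕 (⇑φ) ξ := by
    rw [← SchwartzMap.fourier_coe]
    refine ((𝓕 φ : SchwartzMap ℝ ℂ).integrable).bdd_mul (c := 1)
      (by fun_prop) (Eventually.of_forall fun ξ => ?_)
    rw [Complex.norm_exp_ofReal_mul_I]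
  rw [← integral_fourier_mul hK1 h5, Real.fourierInv_eq']
  refine integral_congr_ae (Eventually.of_forall fun ξ => ?_)
  simp only [smul_eq_mul]
  rw [hm, SchwartzMap.fourier_coe]
  simp
  ring_nf

/-! ### The Mellin transform of `1 / (1 + x)` and its rotations -/

/-- The logistic substitution in the integrand of the beta integral `B(z, 1 - z)`. -/
lemma betaIntegrand_sigmoid (z : ℂ) (r : ℝ) :
    |r.sigmoid * (1 - r.sigmoid)| • ((r.sigmoid : ℂ) ^ (z - 1) * (1 - (r.sigmoid : ℂ)) ^ (1 - z - 1)) =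
      Complex.exp (z * r) / (1 + Complex.exp r) := by
  have hs := Real.sigmoid_pos r
  have ht := Real.sigmoid_pos (-r)
  have hst : r.sigmoid = Real.exp r * (-r).sigmoid := by
    rw [← Real.sigmoid_mul_rexp_neg r, mul_comm r.sigmoid, ← mul_assoc, ← Real.exp_add]; simp
  have ht' : (-r).sigmoid = (1 + Real.exp r)⁻¹ := by rw [Real.sigmoid_def, neg_neg]
  have hlog : Real.log r.sigmoid = r + Real.log (-r).sigmoid := by
    rw [hst, Real.log_mul (Real.exp_pos r).ne' ht.ne', Real.log_exp]
  rw [← Real.sigmoid_neg, abs_of_pos (mul_pos hs ht)]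
  have h1 : (1 : ℂ) - (r.sigmoid : ℂ) = ((-r).sigmoid : ℂ) := by
    rw [Real.sigmoid_neg]; push_cast; ring
  have hs0 : (r.sigmoid : ℂ) ≠ 0 := by exact_mod_cast hs.ne'
  have ht0 : ((-r).sigmoid : ℂ) ≠ 0 := by exact_mod_cast ht.ne'
  rw [h1, Complex.cpow_def_of_ne_zero hs0, Complex.cpow_def_of_ne_zero ht0,
    ← Complex.ofReal_log hs.le, ← Complex.ofReal_log ht.le, hlog, ← Complex.exp_add]
  have h2 : ((r + Real.log (-r).sigmoid : ℝ) : ℂ) * (z - 1) +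
      (Real.log (-r).sigmoid : ℂ) * (1 - z - 1) =
      z * r + (-(r : ℂ) + -(Real.log (-r).sigmoid : ℂ)) := by push_cast; ring
  have h3 : Complex.exp (-(Real.log (-r).sigmoid : ℂ)) = ((-r).sigmoid : ℂ)⁻¹ := by
    rw [Complex.exp_neg, ← Complex.ofReal_exp, Real.exp_log ht]
  rw [h2, Complex.exp_add, Complex.exp_add, h3, Complex.exp_neg, Complex.real_smul, hst]
  have h4 : (1 : ℂ) + Complex.exp r ≠ 0 := by
    rw [← Complex.ofReal_exp]; norm_cast; positivity
  rw [ht']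
  push_cast
  field_simp

lemma hasDerivWithinAt_sigmoid (r : ℝ) (_ : r ∈ (univ : Set ℝ)) :
    HasDerivWithinAt Real.sigmoid (r.sigmoid * (1 - r.sigmoid)) univ r :=
  (Real.hasDerivAt_sigmoid r).hasDerivWithinAt

lemma integrable_exp_div_one_add_exp {z : ℂ} (h0 : 0 < z.re) (h1 : z.re < 1) :
    Integrable fun r : ℝ => Complex.exp (z * r) / (1 + Complex.exp r) := by
  have h := (intervalIntegrable_iff_integrableOn_Ioo_of_le zero_le_one).1
    (Complex.betaIntegral_convergent (u := z) (v := 1 - z) h0 (by simpa using h1))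
  rw [← Real.range_sigmoid, ← image_univ, integrableOn_image_iff_integrableOn_abs_deriv_smul
    MeasurableSet.univ hasDerivWithinAt_sigmoid Real.sigmoid_injective.injOn,
    integrableOn_univ] at h
  simpa only [betaIntegrand_sigmoid] using h

lemma integral_exp_div_one_add_exp {z : ℂ} (h0 : 0 < z.re) (h1 : z.re < 1) :
    ∫ r : ℝ, Complex.exp (z * r) / (1 + Complex.exp r) = Real.pi / Complex.sin (Real.pi * z) := by
  have h := Complex.Gamma_mul_Gamma_eq_betaIntegral (s := z) (t := 1 - z) h0 (by simpa using h1)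
  rw [Complex.Gamma_mul_Gamma_one_sub, add_sub_cancel, Complex.Gamma_one, one_mul] at h
  rw [h, Complex.betaIntegral, intervalIntegral.integral_of_le zero_le_one,
    integral_Ioc_eq_integral_Ioo, ← Real.range_sigmoid, ← image_univ,
    integral_image_eq_integral_abs_deriv_smul
    MeasurableSet.univ hasDerivWithinAt_sigmoid Real.sigmoid_injective.injOn, Measure.restrict_univ]
  simp only [betaIntegrand_sigmoid]

lemma integrable_rexp_div_one_add_rexp {a : ℝ} (h0 : 0 < a) (h1 : a < 1) :
    Integrable fun r : ℝ => Real.exp (a * r) / (1 + Real.exp r) := by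
  have h := (integrable_exp_div_one_add_exp (z := a) (by simpa) (by simpa)).re
  refine h.congr (Eventually.of_forall fun r => ?_)
  have : Complex.exp (a * r) / (1 + Complex.exp r) = ((Real.exp (a * r) / (1 + Real.exp r) : ℝ) : ℂ) := by
    push_cast; rfl
  simp only [this]
  exact Complex.ofReal_re _

/-- A quantitative form of `1 + e ^ w ≠ 0` in the strip `|Im w| < π`. -/
lemma cos_half_mul_le_norm_one_add_exp {w : ℂ} {b : ℝ} (hw : |w.im| ≤ b) (hb : b ≤ Real.pi) :
    Real.cos (b / 2) * (1 + Real.exp w.re) ≤ ‖1 + Complex.exp w‖ := by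
  have hb0 : 0 ≤ b := (abs_nonneg _).trans hw
  have hc0 : 0 ≤ Real.cos (b / 2) :=
    Real.cos_nonneg_of_neg_pi_div_two_le_of_le (by linarith) (by linarith)
  have hcb : Real.cos (b / 2) ^ 2 ≤ Real.cos (w.im / 2) ^ 2 := by
    rw [← Real.cos_abs (w.im / 2)]
    refine pow_le_pow_left₀ hc0 (Real.cos_le_cos_of_nonneg_of_le_pi (abs_nonneg _)
      (by linarith) ?_) 2
    rw [abs_div, abs_two]; linarith
  refine abs_le_of_sq_le_sq' ?_ (norm_nonneg _) |>.2
  have hn : ‖1 + Complex.exp w‖ ^ 2 = (1 + Real.exp w.re) ^ 2 -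
      4 * Real.exp w.re * (1 - Real.cos (w.im / 2) ^ 2) := by
    rw [Complex.sq_norm, Complex.normSq_apply]
    simp only [Complex.add_re, Complex.add_im, Complex.one_re, Complex.one_im, Complex.exp_re,
      Complex.exp_im]
    have e1 : Real.cos w.im = 2 * Real.cos (w.im / 2) ^ 2 - 1 := by
      rw [← Real.cos_two_mul]; congr 1; ring
    have e2 := Real.sin_sq_add_cos_sq w.im
    rw [e1] at *
    linear_combination Real.exp w.re ^ 2 * e2
  rw [hn, mul_pow]
  have h5 : Real.cos (w.im / 2) ^ 2 ≤ 1 := by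
    have := Real.sin_sq_add_cos_sq (w.im / 2); nlinarith [sq_nonneg (Real.sin (w.im / 2))]
  nlinarith [sq_nonneg (1 - Real.exp w.re), Real.exp_pos w.re,
    mul_le_mul_of_nonneg_right hcb (sq_nonneg (1 + Real.exp w.re)),
    mul_nonneg (sub_nonneg.2 h5) (sq_nonneg (1 - Real.exp w.re))]

lemma le_norm_one_add_exp_shift {ℓ : ℂ} {a b : ℝ} (ha : a ≤ ℓ.re) (ha0 : a ≤ 0)
    (hb : |ℓ.im| ≤ b) (hbπ : b < Real.pi) (r : ℝ) :
    Real.cos (b / 2) * Real.exp a * (1 + Real.exp r) ≤ ‖1 + Complex.exp (r + ℓ)‖ := by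
  have hb0 : 0 ≤ b := (abs_nonneg _).trans hb
  have hc0 : 0 ≤ Real.cos (b / 2) :=
    Real.cos_nonneg_of_neg_pi_div_two_le_of_le (by linarith) (by linarith)
  have h := cos_half_mul_le_norm_one_add_exp (w := r + ℓ) (b := b) (by simpa using hb) hbπ.le
  refine le_trans ?_ h
  rw [mul_assoc]
  refine mul_le_mul_of_nonneg_left ?_ hc0
  have h1 : Real.exp a * Real.exp r ≤ Real.exp ((r + ℓ : ℂ)).re := by
    rw [← Real.exp_add]; apply Real.exp_le_exp.2; simp; linarith
  have h2 : Real.exp a ≤ 1 := Real.exp_le_one_iff.2 ha0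
  linarith

lemma cos_half_pos {b : ℝ} (hb0 : 0 ≤ b) (hbπ : b < Real.pi) : 0 < Real.cos (b / 2) :=
  Real.cos_pos_of_mem_Ioo ⟨by linarith [Real.pi_pos], by linarith⟩

lemma one_add_exp_ne_zero {ℓ : ℂ} (hℓ : |ℓ.im| < Real.pi) (r : ℝ) :
    1 + Complex.exp (r + ℓ) ≠ 0 := by
  have h := cos_half_mul_le_norm_one_add_exp (w := r + ℓ) (b := |ℓ.im|) (by simp) hℓ.le
  have := cos_half_pos (abs_nonneg _) hℓ
  rw [← norm_pos_iff]
  exact (by positivity : (0 : ℝ) < _).trans_le h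

lemma continuous_shifted_kernel (z : ℂ) {ℓ : ℂ} (hℓ : |ℓ.im| < Real.pi) :
    Continuous fun r : ℝ => Complex.exp (z * r) / (1 + Complex.exp (r + ℓ)) :=
  Continuous.div (by fun_prop) (by fun_prop) (one_add_exp_ne_zero hℓ)

lemma norm_cexp_mul_ofReal (z : ℂ) (r : ℝ) : ‖Complex.exp (z * r)‖ = Real.exp (z.re * r) := by
  rw [Complex.norm_exp]; simp

/-- The kernel `e^{zr} / (1 + e^{r+ℓ})` is dominated by a multiple of the one for real
`z` and `ℓ = 0`. -/
lemma exists_norm_shifted_kernel_le {ℓ : ℂ} (hℓ : |ℓ.im| < Real.pi) :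
    ∃ C : ℝ, 0 < C ∧ ∀ (z : ℂ) (r : ℝ), ‖Complex.exp (z * r) / (1 + Complex.exp (r + ℓ))‖ ≤
      C * (Real.exp (z.re * r) / (1 + Real.exp r)) := by
  have hc := cos_half_pos (abs_nonneg _) hℓ
  refine ⟨(Real.cos (|ℓ.im| / 2) * Real.exp (min ℓ.re 0))⁻¹, by positivity, fun z r => ?_⟩
  have h := le_norm_one_add_exp_shift (min_le_left ℓ.re 0) (min_le_right ℓ.re 0) le_rfl hℓ r
  rw [norm_div, norm_cexp_mul_ofReal, inv_mul_eq_div, div_div, mul_comm (1 + Real.exp r)]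
  exact div_le_div_of_nonneg_left (Real.exp_pos _).le (by positivity) h

lemma integrable_shifted_kernel {z ℓ : ℂ} (h0 : 0 < z.re) (h1 : z.re < 1)
    (hℓ : |ℓ.im| < Real.pi) :
    Integrable fun r : ℝ => Complex.exp (z * r) / (1 + Complex.exp (r + ℓ)) := by
  obtain ⟨C, -, hC⟩ := exists_norm_shifted_kernel_le hℓ
  exact ((integrable_rexp_div_one_add_rexp h0 h1).const_mul C).mono'
    (continuous_shifted_kernel z hℓ).aestronglyMeasurable (Eventually.of_forall (hC z))

lemma differentiableAt_integral_shifted_kernel {z ℓ₀ : ℂ} (h0 : 0 < z.re) (h1 : z.re < 1)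
    (hℓ : |ℓ₀.im| < Real.pi) :
    DifferentiableAt ℂ
      (fun ℓ : ℂ => ∫ r : ℝ, Complex.exp (z * r) / (1 + Complex.exp (r + ℓ))) ℓ₀ := by
  set b := (|ℓ₀.im| + Real.pi) / 2 with hb
  set a := min (ℓ₀.re - 1) 0 with ha
  have hbπ : b < Real.pi := by rw [hb]; linarith
  have hb0 : 0 ≤ b := by have := abs_nonneg ℓ₀.im; have := Real.pi_pos; positivity
  have hc := cos_half_pos hb0 hbπ
  let U : Set ℂ := {ℓ | ℓ₀.re - 1 < ℓ.re ∧ |ℓ.im| < b}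
  have hUo : IsOpen U := (isOpen_lt continuous_const Complex.continuous_re).inter
    (isOpen_lt Complex.continuous_im.abs continuous_const)
  have hU0 : ℓ₀ ∈ U := ⟨by linarith, by rw [hb]; linarith⟩
  have hUπ : ∀ ℓ ∈ U, |ℓ.im| < Real.pi := fun ℓ h => h.2.trans hbπ
  refine (hasDerivAt_integral_of_dominated_loc_of_deriv_le (hUo.mem_nhds hU0)
    (F' := fun ℓ (r : ℝ) => -(Complex.exp (z * r) * Complex.exp (r + ℓ)) / (1 + Complex.exp (r + ℓ)) ^ 2)
    (bound := fun r => (Real.cos (b / 2) * (Real.cos (b / 2) * Real.exp a))⁻¹ *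
      (Real.exp (z.re * r) / (1 + Real.exp r))) ?_
    (integrable_shifted_kernel h0 h1 hℓ) ?_ ?_
    ((integrable_rexp_div_one_add_rexp h0 h1).const_mul _) ?_).2.differentiableAt
  · filter_upwards [hUo.mem_nhds hU0] with ℓ hℓU
    exact (continuous_shifted_kernel z (hUπ ℓ hℓU)).aestronglyMeasurable
  · exact (Continuous.div (by fun_prop) (by fun_prop)
      fun r => pow_ne_zero 2 (one_add_exp_ne_zero hℓ r)).aestronglyMeasurable
  · refine Eventually.of_forall fun r ℓ hℓU => ?_
    have e1 := le_norm_one_add_exp_shift (a := a) ((min_le_left _ _).trans hℓU.1.le)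
      (min_le_right _ _) hℓU.2.le hbπ r
    have e2 := cos_half_mul_le_norm_one_add_exp (w := r + ℓ) (b := b)
      (by simpa using hℓU.2.le) hbπ.le
    have e3 : ‖Complex.exp (r + ℓ)‖ = Real.exp (r + ℓ : ℂ).re := Complex.norm_exp _
    have hpos : 0 < ‖1 + Complex.exp (r + ℓ)‖ :=
      norm_pos_iff.2 (one_add_exp_ne_zero (hUπ ℓ hℓU) r)
    rw [norm_div, norm_neg, norm_mul, norm_cexp_mul_ofReal, e3, norm_pow, inv_mul_eq_div, div_div,
      div_le_div_iff₀ (by positivity) (by positivity), mul_assoc]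
    refine mul_le_mul_of_nonneg_left ?_ (Real.exp_pos _).le
    have e4 : Real.cos (b / 2) * Real.exp (r + ℓ : ℂ).re ≤ ‖1 + Complex.exp (r + ℓ)‖ :=
      le_trans (by nlinarith) e2
    calc Real.exp (r + ℓ : ℂ).re * ((1 + Real.exp r) * (Real.cos (b / 2) * (Real.cos (b / 2) * Real.exp a)))
        = (Real.cos (b / 2) * Real.exp (r + ℓ : ℂ).re) *
          (Real.cos (b / 2) * Real.exp a * (1 + Real.exp r)) := by ring
      _ ≤ ‖1 + Complex.exp (r + ℓ)‖ * ‖1 + Complex.exp (r + ℓ)‖ :=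
          mul_le_mul e4 e1 (by positivity) (norm_nonneg _)
      _ = _ := by ring
  · refine Eventually.of_forall fun r ℓ hℓU => ?_
    have hd : HasDerivAt (fun ℓ : ℂ => 1 + Complex.exp (r + ℓ)) (Complex.exp (r + ℓ)) ℓ := by
      simpa using (((hasDerivAt_id ℓ).const_add (r : ℂ)).cexp).const_add 1
    convert! (hasDerivAt_const ℓ (Complex.exp (z * r))).div hd
      (one_add_exp_ne_zero (hUπ ℓ hℓU) r) using 1
    simp

/-- Analytic continuation in `ℓ` of the Mellin transform of `1 / (1 + x)`: for real `ℓ` this is a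
translation of the integral, and both sides are holomorphic in the strip `|Im ℓ| < π`. -/
lemma integral_shifted_kernel {z ℓ : ℂ} (h0 : 0 < z.re) (h1 : z.re < 1)
    (hℓ : |ℓ.im| < Real.pi) :
    ∫ r : ℝ, Complex.exp (z * r) / (1 + Complex.exp (r + ℓ)) =
      Complex.exp (-(z * ℓ)) * (Real.pi / Complex.sin (Real.pi * z)) := by
  let D : Set ℂ := {ℓ | |ℓ.im| < Real.pi}
  have hDo : IsOpen D := isOpen_lt Complex.continuous_im.abs continuous_const
  have hDc : Convex ℝ D := by
    have : D = Complex.imLm ⁻¹' (Ioo (-Real.pi) Real.pi) := by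
      ext w; simp [D, abs_lt]
    rw [this]
    exact (convex_Ioo _ _).is_linear_preimage Complex.imLm.isLinear
  have hreal : ∀ x : ℝ, ∫ r : ℝ, Complex.exp (z * r) / (1 + Complex.exp (r + x)) =
      Complex.exp (-(z * x)) * (Real.pi / Complex.sin (Real.pi * z)) := by
    intro x
    rw [← integral_exp_div_one_add_exp h0 h1, ← integral_const_mul,
      ← integral_add_right_eq_self (fun r : ℝ => Complex.exp (-(z * x)) *
        (Complex.exp (z * r) / (1 + Complex.exp r))) x]
    refine integral_congr_ae (Eventually.of_forall fun r => ?_)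
    simp only
    rw [← mul_div_assoc, ← Complex.exp_add]
    push_cast
    congr 2
    ring
  have hfreq : ∃ᶠ w : ℂ in 𝓝[≠] 0, ∫ r : ℝ, Complex.exp (z * r) / (1 + Complex.exp (r + w)) =
      Complex.exp (-(z * w)) * (Real.pi / Complex.sin (Real.pi * z)) := by
    have ht : Tendsto (fun x : ℝ => (x : ℂ)) (𝓝[≠] 0) (𝓝[≠] 0) := by
      refine tendsto_nhdsWithin_of_tendsto_nhds_of_eventually_within _ ?_ ?_
      · exact (Complex.continuous_ofReal.tendsto' 0 0 (by simp)).mono_left nhdsWithin_le_nhds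
      · filter_upwards [self_mem_nhdsWithin] with x hx
        simpa using hx
    exact ht.frequently (Eventually.of_forall hreal).frequently
  refine AnalyticOnNhd.eqOn_of_preconnected_of_frequently_eq (U := D) (z₀ := 0) ?_ ?_
    hDc.isPreconnected (by simp [D, Real.pi_pos]) hfreq hℓ
  · exact DifferentiableOn.analyticOnNhd (fun w hw =>
      (differentiableAt_integral_shifted_kernel h0 h1 hw).differentiableWithinAt) hDo
  · exact DifferentiableOn.analyticOnNhd (Differentiable.differentiableOn (by fun_prop)) hDo

/-! ### Logarithmic coordinates on the half line -/

lemma hasDerivWithinAt_exp_univ (s : ℝ) (_ : s ∈ (univ : Set ℝ)) :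
    HasDerivWithinAt Real.exp (Real.exp s) univ s :=
  (Real.hasDerivAt_exp s).hasDerivWithinAt

lemma image_exp_univ : Real.exp '' univ = Ioi 0 := by
  rw [image_univ, Real.range_exp]

lemma lintegral_Ioi_eq_lintegral_exp (g : ℝ → ℝ≥0∞) :
    ∫⁻ x in Ioi 0, g x = ∫⁻ s, ENNReal.ofReal (Real.exp s) * g (Real.exp s) := by
  rw [← image_exp_univ, lintegral_image_eq_lintegral_abs_deriv_mul MeasurableSet.univ
    hasDerivWithinAt_exp_univ Real.exp_injective.injOn, Measure.restrict_univ]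
  simp only [abs_of_pos (Real.exp_pos _)]

lemma integral_Ioi_eq_integral_exp (g : ℝ → ℂ) :
    ∫ x in Ioi 0, g x = ∫ s, (Real.exp s : ℂ) * g (Real.exp s) := by
  rw [← image_exp_univ, integral_image_eq_integral_abs_deriv_smul MeasurableSet.univ
    hasDerivWithinAt_exp_univ Real.exp_injective.injOn, Measure.restrict_univ]
  simp only [abs_of_pos (Real.exp_pos _), Complex.real_smul]

lemma lintegral_halfMeasure (α : ℝ) (g : ℝ → ℝ≥0∞) :
    ∫⁻ x, g x ∂(halfMeasure α) = ∫⁻ x in Ioi 0, ENNReal.ofReal (x ^ (2 * α - 1)) * g x := by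
  rw [halfMeasure, lintegral_withDensity_eq_lintegral_mul_non_measurable]
  · rfl
  · fun_prop
  · exact Eventually.of_forall fun x => ENNReal.ofReal_lt_top

lemma lintegral_halfMeasure_exp (α : ℝ) (g : ℝ → ℝ≥0∞) :
    ∫⁻ x, g x ∂(halfMeasure α) =
      ∫⁻ s, ENNReal.ofReal (Real.exp (2 * α * s)) * g (Real.exp s) := by
  rw [lintegral_halfMeasure, lintegral_Ioi_eq_lintegral_exp]
  refine lintegral_congr fun s => ?_
  rw [← mul_assoc, ← ENNReal.ofReal_mul (Real.exp_pos s).le, ← Real.exp_mul, ← Real.exp_add]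
  congr 3
  ring

/-- The measure `x^(2α-1) dx` is the image of `e^(2αs) ds` under the exponential. -/
lemma halfMeasure_eq_map (α : ℝ) : halfMeasure α =
    (volume.withDensity fun s => ENNReal.ofReal (Real.exp (2 * α * s))).map Real.exp := by
  ext A hA
  rw [Measure.map_apply Real.measurable_exp hA, withDensity_apply _ (Real.measurable_exp hA),
    ← lintegral_indicator_one hA, lintegral_halfMeasure_exp,
    ← lintegral_indicator (Real.measurable_exp hA)]
  refine lintegral_congr fun s => ?_
  by_cases h : Real.exp s ∈ A <;> simp [indicator, h]

lemma ae_halfMeasure_iff_ae_exp {α : ℝ} {p : ℝ → Prop} :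
    (∀ᵐ x ∂(halfMeasure α), p x) ↔ ∀ᵐ s : ℝ, p (Real.exp s) := by
  have hm : Measurable fun s : ℝ => ENNReal.ofReal (Real.exp (2 * α * s)) := by fun_prop
  rw [halfMeasure_eq_map, (Real.continuous_exp.measurableEmbedding Real.exp_injective).ae_map_iff]
  constructor <;> intro h
  · exact (withDensity_absolutelyContinuous' hm.aemeasurable
      (Eventually.of_forall fun s => by simp [Real.exp_pos])).ae_le h
  · exact (withDensity_absolutelyContinuous _ _).ae_le h

lemma ae_restrict_Ioi_iff_ae_exp {p : ℝ → Prop} :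
    (∀ᵐ x ∂(volume.restrict (Ioi (0 : ℝ))), p x) ↔ ∀ᵐ s : ℝ, p (Real.exp s) := by
  have h : halfMeasure (1 / 2) = volume.restrict (Ioi (0 : ℝ)) := by
    simp [halfMeasure]
  rw [← h, ae_halfMeasure_iff_ae_exp]

lemma quasiMeasurePreserving_exp (α : ℝ) :
    Measure.QuasiMeasurePreserving Real.exp volume (halfMeasure α) :=
  ⟨Real.measurable_exp, Measure.AbsolutelyContinuous.mk fun A hA h => by
    rw [Measure.map_apply Real.measurable_exp hA]
    exact measure_eq_zero_iff_ae_notMem.2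
      (ae_halfMeasure_iff_ae_exp.1 (measure_eq_zero_iff_ae_notMem.1 h))⟩

lemma quasiMeasurePreserving_log (α : ℝ) :
    Measure.QuasiMeasurePreserving Real.log (halfMeasure α) volume := by
  refine ⟨Real.measurable_log, ?_⟩
  rw [halfMeasure_eq_map, Measure.map_map Real.measurable_log Real.measurable_exp]
  have : Real.log ∘ Real.exp = id := funext fun s => Real.log_exp s
  rw [this, Measure.map_id]
  exact withDensity_absolutelyContinuous _ _

lemma eLpNorm_two_halfMeasure (α : ℝ) (f : ℝ → ℂ) :
    eLpNorm f 2 (halfMeasure α) =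
      eLpNorm (fun s => (Real.exp (α * s) : ℂ) * f (Real.exp s)) 2 volume := by
  rw [eLpNorm_eq_lintegral_rpow_enorm_toReal two_ne_zero ENNReal.ofNat_ne_top,
    eLpNorm_eq_lintegral_rpow_enorm_toReal two_ne_zero ENNReal.ofNat_ne_top,
    lintegral_halfMeasure_exp]
  congr 1
  refine lintegral_congr fun s => ?_
  have h : ‖(Real.exp (α * s) : ℂ)‖ₑ = ENNReal.ofReal (Real.exp (α * s)) := by
    rw [← ofReal_norm, Complex.norm_real, Real.norm_of_nonneg (Real.exp_pos _).le]
  rw [enorm_mul, h, ENNReal.mul_rpow_of_nonneg _ _ (by norm_num),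
    ENNReal.ofReal_rpow_of_nonneg (Real.exp_pos _).le (by norm_num), ← Real.exp_mul]
  congr 3
  simp
  ring

lemma memLp_two_halfMeasure_iff {α : ℝ} {f : ℝ → ℂ} :
    MemLp f 2 (halfMeasure α) ↔ MemLp (fun s => (Real.exp (α * s) : ℂ) * f (Real.exp s)) 2 := by
  rw [MemLp, MemLp, eLpNorm_two_halfMeasure]
  refine and_congr_left fun _ => ⟨fun h => ?_, fun h => ?_⟩
  · exact (by fun_prop : Continuous fun s : ℝ => (Real.exp (α * s) : ℂ)).aestronglyMeasurable.mul
      (h.comp_quasiMeasurePreserving (quasiMeasurePreserving_exp α))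
  · have h1 := h.comp_quasiMeasurePreserving (quasiMeasurePreserving_log α)
    have h2 : AEStronglyMeasurable (fun x => ((Real.exp (α * Real.log x))⁻¹ : ℂ)) (halfMeasure α) := by
      refine Measurable.aestronglyMeasurable ?_
      fun_prop
    refine (h2.mul h1).congr ?_
    refine ae_halfMeasure_iff_ae_exp.2 (Eventually.of_forall fun s => ?_)
    simp only [Pi.mul_apply, Function.comp_apply, Real.log_exp]
    rw [inv_mul_cancel_left₀]
    exact_mod_cast (Real.exp_pos _).ne'

/-- The unitary map `f ↦ e^(αs) f(e^s)` from `L²(ℝ₊; x^(2α-1) dx)` onto `L²(ℝ)`. -/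
noncomputable def logCoord (α : ℝ) : Lp ℂ 2 (halfMeasure α) ≃ₗᵢ[ℂ] Lp ℂ 2 (volume : Measure ℝ) :=
  LinearIsometryEquiv.ofSurjective
    { toFun := fun f => (memLp_two_halfMeasure_iff.1 (Lp.memLp f)).toLp
      map_add' := fun f g => by
        ext1
        refine (MemLp.coeFn_toLp _).trans ?_
        filter_upwards [ae_halfMeasure_iff_ae_exp.1 (Lp.coeFn_add f g),
          Lp.coeFn_add (memLp_two_halfMeasure_iff.1 (Lp.memLp f)).toLp
            (memLp_two_halfMeasure_iff.1 (Lp.memLp g)).toLp,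
          (memLp_two_halfMeasure_iff.1 (Lp.memLp f)).coeFn_toLp,
          (memLp_two_halfMeasure_iff.1 (Lp.memLp g)).coeFn_toLp] with ξ h1 h2 h3 h4
        rw [h2, h1, Pi.add_apply, Pi.add_apply, h3, h4, mul_add]
      map_smul' := fun c f => by
        ext1
        refine (MemLp.coeFn_toLp _).trans ?_
        filter_upwards [ae_halfMeasure_iff_ae_exp.1 (Lp.coeFn_smul c f),
          Lp.coeFn_smul c (memLp_two_halfMeasure_iff.1 (Lp.memLp f)).toLp,
          (memLp_two_halfMeasure_iff.1 (Lp.memLp f)).coeFn_toLp] with ξ h1 h2 h3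
        simp only [RingHom.id_apply]
        rw [h2, h1, Pi.smul_apply, Pi.smul_apply, h3, smul_eq_mul, smul_eq_mul]
        ring
      norm_map' := fun f => by
        simp only [LinearMap.coe_mk, AddHom.coe_mk]
        rw [Lp.norm_toLp, Lp.norm_def, eLpNorm_two_halfMeasure] }
    (by
      intro F
      have hF : (fun s => (Real.exp (α * s) : ℂ) *
          (fun x => ((Real.exp (α * Real.log x))⁻¹ : ℂ) * F (Real.log x)) (Real.exp s)) = F := by
        funext s
        simp only [Real.log_exp]
        rw [mul_inv_cancel_left₀]
        exact_mod_cast (Real.exp_pos _).ne'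
      have hf : MemLp (fun x => ((Real.exp (α * Real.log x))⁻¹ : ℂ) * F (Real.log x)) 2
          (halfMeasure α) := memLp_two_halfMeasure_iff.2 (by rw [hF]; exact Lp.memLp F)
      refine ⟨hf.toLp, ?_⟩
      ext1
      refine (memLp_two_halfMeasure_iff.1 (Lp.memLp (hf.toLp _))).coeFn_toLp.trans ?_
      filter_upwards [ae_halfMeasure_iff_ae_exp.1 hf.coeFn_toLp] with s hs
      rw [hs]
      exact congrFun hF s)

lemma coeFn_logCoord (α : ℝ) (f : Lp ℂ 2 (halfMeasure α)) :
    logCoord α f =ᵐ[volume] fun s => (Real.exp (α * s) : ℂ) * f (Real.exp s) :=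
  (memLp_two_halfMeasure_iff.1 (Lp.memLp f)).coeFn_toLp

lemma halfDensity_smul_pairing (α : ℝ) (g : ℝ → ℂ) :
    EqOn (fun x => (ENNReal.ofReal (x ^ (2 * α - 1))).toReal •
      (((x ^ (1 - 2 * α) : ℝ) : ℂ) * g x)) g (Ioi 0) := by
  intro x hx
  have hx : 0 < x := hx
  simp only
  rw [ENNReal.toReal_ofReal (by positivity), Complex.real_smul, ← mul_assoc, ← Complex.ofReal_mul,
    ← Real.rpow_add hx]
  simp

lemma integral_halfMeasure_pairing (α : ℝ) (g : ℝ → ℂ) :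
    ∫ x, ((x ^ (1 - 2 * α) : ℝ) : ℂ) * g x ∂(halfMeasure α) = ∫ x in Ioi 0, g x := by
  rw [halfMeasure, integral_withDensity_eq_integral_toReal_smul (by fun_prop)
    (Eventually.of_forall fun x => ENNReal.ofReal_lt_top)]
  exact setIntegral_congr_fun measurableSet_Ioi (halfDensity_smul_pairing α g)

lemma integrable_halfMeasure_pairing {α : ℝ} {g : ℝ → ℂ}
    (h : Integrable (fun x => ((x ^ (1 - 2 * α) : ℝ) : ℂ) * g x) (halfMeasure α)) :
    IntegrableOn g (Ioi 0) := by
  rw [halfMeasure, integrable_withDensity_iff_integrable_smul' (by fun_prop)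
    (Eventually.of_forall fun x => ENNReal.ofReal_lt_top)] at h
  exact (integrableOn_congr_fun (halfDensity_smul_pairing α g) measurableSet_Ioi).1 h

lemma integrableOn_mul_of_memLp {α : ℝ} {κ : ℝ → ℂ}
    (hκ : MemLp (fun x => ((x ^ (1 - 2 * α) : ℝ) : ℂ) * κ x) 2 (halfMeasure α))
    (f : Lp ℂ 2 (halfMeasure α)) : IntegrableOn (fun t => κ t * f t) (Ioi 0) := by
  refine integrable_halfMeasure_pairing (α := α) ?_
  simp_rw [← mul_assoc]
  exact hκ.integrable_mul (Lp.memLp f)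

lemma continuous_integral_mul_of_memLp {α : ℝ} {κ : ℝ → ℂ}
    (hκ : MemLp (fun x => ((x ^ (1 - 2 * α) : ℝ) : ℂ) * κ x) 2 (halfMeasure α)) :
    Continuous fun f : Lp ℂ 2 (halfMeasure α) => ∫ t in Ioi 0, κ t * f t := by
  simp_rw [← integral_halfMeasure_pairing α, ← mul_assoc]
  exact continuous_integral_mul_of_memLp_two hκ

/-! ### Abel summation of principal values -/

/-- The probability density on `(0, ∞)` that averages the truncations of the Hilbert kernel into
the conjugate Poisson kernel. -/
noncomputable def abelWeight (s : ℝ) : ℝ := 2 * s / (1 + s ^ 2) ^ 2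

lemma hasDerivAt_abelWeight (s : ℝ) :
    HasDerivAt (fun s : ℝ => s ^ 2 / (1 + s ^ 2)) (abelWeight s) s := by
  have h1 : HasDerivAt (fun s : ℝ => s ^ 2) (2 * s) s := by simpa using hasDerivAt_pow 2 s
  have h2 : (1 + s ^ 2) ≠ 0 := by positivity
  convert! h1.div (h1.const_add 1) h2 using 1
  rw [abelWeight]
  ring

lemma continuous_abelWeight : Continuous abelWeight := by
  unfold abelWeight
  exact Continuous.div (by fun_prop) (by fun_prop) fun s => by positivity

lemma tendsto_abelPrimitive : Tendsto (fun s : ℝ => s ^ 2 / (1 + s ^ 2)) atTop (𝓝 1) := by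
  have h : Tendsto (fun s : ℝ => 1 - (1 + s ^ 2)⁻¹) atTop (𝓝 (1 - 0)) :=
    tendsto_const_nhds.sub (tendsto_inv_atTop_zero.comp
      (tendsto_atTop_add_const_left _ _ (tendsto_pow_atTop two_ne_zero)))
  rw [sub_zero] at h
  refine h.congr fun s => ?_
  have h2 : (1 + s ^ 2) ≠ 0 := by positivity
  field_simp
  ring

lemma abelWeight_nonneg {s : ℝ} (hs : 0 ≤ s) : 0 ≤ abelWeight s := by
  unfold abelWeight; positivity

lemma integrableOn_abelWeight : IntegrableOn abelWeight (Ioi 0) :=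
  integrableOn_Ioi_deriv_of_nonneg' (fun s _ => hasDerivAt_abelWeight s)
    (fun _ hs => abelWeight_nonneg (le_of_lt hs)) tendsto_abelPrimitive

lemma integral_abelWeight : ∫ s in Ioi 0, abelWeight s = 1 := by
  rw [integral_Ioi_of_hasDerivAt_of_tendsto' (fun s _ => hasDerivAt_abelWeight s)
    integrableOn_abelWeight tendsto_abelPrimitive]
  simp

lemma integral_abelWeight_Ioo {v : ℝ} (hv : 0 ≤ v) :
    ∫ s in Ioo 0 v, abelWeight s = v ^ 2 / (1 + v ^ 2) := by
  rw [← integral_Ioc_eq_integral_Ioo, ← intervalIntegral.integral_of_le hv,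
    intervalIntegral.integral_eq_sub_of_hasDerivAt (fun s _ => hasDerivAt_abelWeight s)
      (continuous_abelWeight.intervalIntegrable _ _)]
  simp

section Abel

variable {f : ℝ → ℂ} {x : ℝ}

lemma truncation_bounded {y : ℂ} (h : HasHalfHilbertAt f x y) :
    ∃ M : ℝ, ∀ ε : ℝ, 0 < ε →
      ‖∫ t in {t : ℝ | 0 < t ∧ ε < |t - x|}, f t / ((t - x : ℝ) : ℂ)‖ ≤ M := by
  have hπ : (1 / (Real.pi : ℂ)) ≠ 0 := by simp [Real.pi_ne_zero]
  have h2 : Tendsto (fun ε : ℝ => ∫ t in {t : ℝ | 0 < t ∧ ε < |t - x|}, f t / ((t - x : ℝ) : ℂ))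
      (𝓝[>] (0 : ℝ)) (𝓝 ((1 / (Real.pi : ℂ))⁻¹ * y)) := by
    refine (h.2.const_mul (1 / (Real.pi : ℂ))⁻¹).congr fun ε => ?_
    rw [inv_mul_cancel_left₀ hπ]
  obtain ⟨M₁, hM₁⟩ : ∃ M₁, ∀ᶠ ε in 𝓝[>] (0 : ℝ),
      ‖∫ t in {t : ℝ | 0 < t ∧ ε < |t - x|}, f t / ((t - x : ℝ) : ℂ)‖ ≤ M₁ :=
    ⟨_, (h2.norm.eventually (gt_mem_nhds (lt_add_one _))).mono fun _ h => le_of_lt h⟩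
  obtain ⟨ε₀, hε₀, hM⟩ := mem_nhdsGT_iff_exists_Ioo_subset.1 hM₁
  have hε₀ : 0 < ε₀ := hε₀
  refine ⟨max M₁ (∫ t in {t : ℝ | 0 < t ∧ ε₀ / 2 < |t - x|}, ‖f t / ((t - x : ℝ) : ℂ)‖),
    fun ε hε => ?_⟩
  rcases lt_or_ge ε ε₀ with hlt | hge
  · exact (hM ⟨hε, hlt⟩ : _ ≤ M₁).trans (le_max_left _ _)
  · refine (norm_integral_le_integral_norm _).trans (le_trans ?_ (le_max_right _ _))
    refine setIntegral_mono_set (h.1 _ (by positivity)).norm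
      (Eventually.of_forall fun t => norm_nonneg _) (LE.le.eventuallyLE ?_)
    rintro t ⟨ht, ht2⟩
    exact ⟨ht, by linarith⟩

/-- The conjugate Poisson integral is an average of truncated Hilbert transforms. -/
lemma conjPoisson_eq_average (hf : AEStronglyMeasurable f (volume.restrict (Ioi 0)))
    {δ : ℝ} (hδ : 0 < δ)
    (hi : IntegrableOn (fun t => (((t - x) / ((t - x) ^ 2 + δ ^ 2) : ℝ) : ℂ) * f t) (Ioi 0)) :
    IntegrableOn (fun s => (abelWeight s : ℂ) *
      ∫ t in {t : ℝ | 0 < t ∧ δ * s < |t - x|}, f t / ((t - x : ℝ) : ℂ)) (Ioi 0) ∧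
    ∫ t in Ioi 0, (((t - x) / ((t - x) ^ 2 + δ ^ 2) : ℝ) : ℂ) * f t =
      ∫ s in Ioi 0, (abelWeight s : ℂ) *
        ∫ t in {t : ℝ | 0 < t ∧ δ * s < |t - x|}, f t / ((t - x : ℝ) : ℂ) := by
  let F : ℝ × ℝ → ℂ := fun p => {p : ℝ × ℝ | δ * p.1 < |p.2 - x|}.indicator
    (fun p => (abelWeight p.1 : ℂ) * (f p.2 / ((p.2 - x : ℝ) : ℂ))) p
  have hmeasD : MeasurableSet {p : ℝ × ℝ | δ * p.1 < |p.2 - x|} :=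
    (isOpen_lt (by fun_prop) (by fun_prop)).measurableSet
  have hFm : AEStronglyMeasurable F ((volume.restrict (Ioi 0)).prod (volume.restrict (Ioi 0))) := by
    refine AEStronglyMeasurable.indicator ?_ hmeasD
    refine AEStronglyMeasurable.mul ?_ ?_
    · exact (Complex.continuous_ofReal.comp
        (continuous_abelWeight.comp continuous_fst)).aestronglyMeasurable
    · refine AEStronglyMeasurable.div₀ hf.comp_snd ?_
      exact (Complex.continuous_ofReal.comp (by fun_prop)).aestronglyMeasurable
  have hslice : ∀ t s, F (s, t) = (Iio (|t - x| / δ)).indicator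
      (fun s => (abelWeight s : ℂ)) s * (f t / ((t - x : ℝ) : ℂ)) := by
    intro t s
    have : δ * s < |t - x| ↔ s < |t - x| / δ := by rw [lt_div_iff₀ hδ, mul_comm]
    by_cases h : s < |t - x| / δ
    · simp [F, indicator, this.2 h, h]
    · simp [F, indicator, this, h]
  have hset : ∀ v : ℝ, Iio v ∩ Ioi 0 = Ioo 0 v := fun v => by
    ext; simp [and_comm]
  have hquot : ∀ t, (|t - x| / δ) ^ 2 / (1 + (|t - x| / δ) ^ 2) = (t - x) ^ 2 / ((t - x) ^ 2 + δ ^ 2) := by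
    intro t
    rw [div_pow, sq_abs]
    have : (t - x) ^ 2 + δ ^ 2 ≠ 0 := by positivity
    field_simp
    rw [add_comm]
  have hker : ∀ t, (((t - x) ^ 2 / ((t - x) ^ 2 + δ ^ 2) : ℝ) : ℂ) * (f t / ((t - x : ℝ) : ℂ)) =
      (((t - x) / ((t - x) ^ 2 + δ ^ 2) : ℝ) : ℂ) * f t := by
    intro t
    rcases eq_or_ne t x with rfl | hne
    · simp
    · have h1 : ((t - x : ℝ) : ℂ) ≠ 0 := by exact_mod_cast sub_ne_zero.2 hne
      have h2 : (((t - x) ^ 2 + δ ^ 2 : ℝ) : ℂ) ≠ 0 := by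
        have : (t - x) ^ 2 + δ ^ 2 ≠ 0 := by positivity
        exact_mod_cast this
      rw [Complex.ofReal_div, Complex.ofReal_div, Complex.ofReal_pow]
      field_simp
  have hint_w : ∀ t, ∫ s in Ioi 0, (Iio (|t - x| / δ)).indicator (fun s => (abelWeight s : ℂ)) s =
      (((t - x) ^ 2 / ((t - x) ^ 2 + δ ^ 2) : ℝ) : ℂ) := by
    intro t
    rw [integral_indicator measurableSet_Iio, Measure.restrict_restrict measurableSet_Iio, hset,
      integral_complex_ofReal, integral_abelWeight_Ioo (by positivity), hquot]
  have hFint : Integrable F ((volume.restrict (Ioi 0)).prod (volume.restrict (Ioi 0))) := by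
    rw [integrable_prod_iff' hFm]
    constructor
    · refine Eventually.of_forall fun t => ?_
      simp_rw [hslice t]
      exact (integrableOn_abelWeight.ofReal.indicator measurableSet_Iio).mul_const _
    · refine hi.norm.congr (Eventually.of_forall fun t => ?_)
      simp only
      rw [← hker, norm_mul]
      simp_rw [hslice t, norm_mul]
      rw [integral_mul_const]
      congr 1
      have hw : ∀ᵐ s ∂(volume.restrict (Ioi (0:ℝ))), ‖(Iio (|t - x| / δ)).indicator (fun s => (abelWeight s : ℂ)) s‖ =
          (Iio (|t - x| / δ)).indicator abelWeight s := by
        filter_upwards [ae_restrict_mem measurableSet_Ioi] with s hs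
        by_cases h : s ∈ Iio (|t - x| / δ)
        · rw [indicator_of_mem h, indicator_of_mem h, Complex.norm_real,
            Real.norm_of_nonneg (abelWeight_nonneg (le_of_lt hs))]
        · rw [indicator_of_notMem h, indicator_of_notMem h, norm_zero]
      rw [integral_congr_ae hw, integral_indicator measurableSet_Iio,
        Measure.restrict_restrict measurableSet_Iio, hset, integral_abelWeight_Ioo (by positivity),
        hquot, Complex.norm_real, Real.norm_of_nonneg (by positivity)]
  have hinner : ∀ s, ∫ t in Ioi 0, F (s, t) = (abelWeight s : ℂ) *
        ∫ t in {t : ℝ | 0 < t ∧ δ * s < |t - x|}, f t / ((t - x : ℝ) : ℂ) := by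
    intro s
    have hD : MeasurableSet {t : ℝ | δ * s < |t - x|} :=
      (isOpen_lt continuous_const (by fun_prop)).measurableSet
    have h1 : ∀ t, F (s, t) = {t : ℝ | δ * s < |t - x|}.indicator
        (fun t => (abelWeight s : ℂ) * (f t / ((t - x : ℝ) : ℂ))) t := fun t => by
      by_cases h : δ * s < |t - x| <;> simp [F, indicator, h]
    simp_rw [h1]
    rw [integral_indicator hD, Measure.restrict_restrict hD, integral_const_mul]
    congr 3
    ext t; simp [and_comm]
  refine ⟨?_, ?_⟩
  · have := hFint.integral_prod_left
    simp_rw [hinner] at this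
    exact this
  · simp_rw [← hinner]
    rw [integral_integral_swap (f := fun s t => F (s, t)) hFint]
    refine integral_congr_ae (Eventually.of_forall fun t => ?_)
    simp only
    simp_rw [hslice t]
    rw [integral_mul_const, hint_w, hker]

/-- Abel summation of the principal value: where the principal value exists, the conjugate Poisson
integrals converge to it. -/
lemma HasHalfHilbertAt.tendsto_conjPoisson {y : ℂ} (h : HasHalfHilbertAt f x y)
    (hf : AEStronglyMeasurable f (volume.restrict (Ioi 0)))
    (hi : ∀ δ : ℝ, 0 < δ →
      IntegrableOn (fun t => (((t - x) / ((t - x) ^ 2 + δ ^ 2) : ℝ) : ℂ) * f t) (Ioi 0)) :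
    Tendsto (fun δ : ℝ => (1 / (Real.pi : ℂ)) *
      ∫ t in Ioi 0, (((t - x) / ((t - x) ^ 2 + δ ^ 2) : ℝ) : ℂ) * f t) (𝓝[>] 0) (𝓝 y) := by
  obtain ⟨M, hM⟩ := truncation_bounded h
  have hlim : Tendsto (fun δ : ℝ => ∫ s in Ioi 0, (1 / (Real.pi : ℂ)) * ((abelWeight s : ℂ) *
        ∫ t in {t : ℝ | 0 < t ∧ δ * s < |t - x|}, f t / ((t - x : ℝ) : ℂ))) (𝓝[>] 0)
      (𝓝 (∫ s in Ioi 0, (abelWeight s : ℂ) * y)) := by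
    refine tendsto_integral_filter_of_dominated_convergence
      (fun s => ‖1 / (Real.pi : ℂ)‖ * (abelWeight s * M)) ?_ ?_
      ((integrableOn_abelWeight.mul_const _).const_mul _) ?_
    · filter_upwards [self_mem_nhdsWithin] with δ hδ
      exact ((conjPoisson_eq_average hf hδ (hi δ hδ)).1.const_mul _).aestronglyMeasurable
    · filter_upwards [self_mem_nhdsWithin] with δ hδ
      filter_upwards [ae_restrict_mem measurableSet_Ioi] with s hs
      rw [norm_mul, norm_mul, Complex.norm_real, Real.norm_of_nonneg (abelWeight_nonneg (le_of_lt hs))]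
      gcongr
      · exact abelWeight_nonneg (le_of_lt hs)
      · exact hM _ (mul_pos hδ hs)
    · filter_upwards [ae_restrict_mem measurableSet_Ioi] with s hs
      have hs : 0 < s := hs
      have ht : Tendsto (fun δ : ℝ => δ * s) (𝓝[>] 0) (𝓝[>] 0) := by
        refine tendsto_nhdsWithin_of_tendsto_nhds_of_eventually_within _ ?_ ?_
        · exact ((continuous_id.mul continuous_const).tendsto' 0 0 (by simp)).mono_left
            nhdsWithin_le_nhds
        · filter_upwards [self_mem_nhdsWithin] with δ hδ
          exact mul_pos hδ hs
      refine ((h.2.comp ht).const_mul (abelWeight s : ℂ)).congr fun δ => ?_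
      simp only [Function.comp_apply]
      ring
  rw [integral_mul_const, integral_complex_ofReal, integral_abelWeight, Complex.ofReal_one,
    one_mul] at hlim
  refine hlim.congr' ?_
  filter_upwards [self_mem_nhdsWithin] with δ hδ
  rw [(conjPoisson_eq_average hf hδ (hi δ hδ)).2, integral_const_mul]

end Abel

/-! ### Symbols -/

/-- The point `α - 2πiξ` at which Mellin transforms are evaluated at frequency `ξ`. -/
noncomputable def mellinPoint (α ξ : ℝ) : ℂ := α + (-(2 * Real.pi * ξ) : ℝ) * Complex.I

lemma continuous_mellinPoint (α : ℝ) : Continuous (mellinPoint α) := by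
  unfold mellinPoint; fun_prop

@[simp] lemma mellinPoint_re (α ξ : ℝ) : (mellinPoint α ξ).re = α := by simp [mellinPoint]

lemma normSq_sin (z : ℂ) :
    ‖Complex.sin z‖ ^ 2 = Real.sin z.re ^ 2 + Real.sinh z.im ^ 2 := by
  rw [Complex.sq_norm, Complex.normSq_apply, Complex.sin_eq]
  rw [← Complex.ofReal_sin, ← Complex.ofReal_cos, ← Complex.ofReal_sinh, ← Complex.ofReal_cosh]
  simp only [Complex.add_re, Complex.add_im, Complex.mul_re, Complex.mul_im, Complex.ofReal_re,
    Complex.ofReal_im, Complex.I_re, Complex.I_im]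
  have h1 := Real.sin_sq_add_cos_sq z.re
  have h2 := Real.cosh_sq z.im
  linear_combination Real.sin z.re ^ 2 * h2 + Real.sinh z.im ^ 2 * h1

lemma normSq_cos (z : ℂ) :
    ‖Complex.cos z‖ ^ 2 = Real.cos z.re ^ 2 + Real.sinh z.im ^ 2 := by
  rw [Complex.sq_norm, Complex.normSq_apply, Complex.cos_eq]
  rw [← Complex.ofReal_sin, ← Complex.ofReal_cos, ← Complex.ofReal_sinh, ← Complex.ofReal_cosh]
  simp only [Complex.sub_re, Complex.sub_im, Complex.mul_re, Complex.mul_im, Complex.ofReal_re,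
    Complex.ofReal_im, Complex.I_re, Complex.I_im]
  have h1 := Real.sin_sq_add_cos_sq z.re
  have h2 := Real.cosh_sq z.im
  linear_combination Real.cos z.re ^ 2 * h2 + Real.sinh z.im ^ 2 * h1

/-- The comparison behind all bounds for the cotangent symbol: adding the same nonnegative number
to numerator and denominator moves a fraction towards `1`. -/
lemma norm_cot_mem_of_sin_le_cos (z : ℂ) (hs : 0 < Real.sin z.re)
    (hsc : Real.sin z.re ≤ Real.cos z.re) :
    1 ≤ ‖Complex.cos z / Complex.sin z‖ ∧
      ‖Complex.cos z / Complex.sin z‖ ≤ Real.cos z.re / Real.sin z.re := by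
  have h1 := normSq_sin z
  have h2 := normSq_cos z
  have hn : 0 < ‖Complex.sin z‖ := by
    by_contra hcon
    have : ‖Complex.sin z‖ = 0 := le_antisymm (not_lt.1 hcon) (norm_nonneg _)
    rw [this] at h1
    nlinarith [sq_nonneg (Real.sinh z.im)]
  rw [norm_div, one_le_div hn, div_le_div_iff₀ hn hs]
  constructor
  · refine abs_le_of_sq_le_sq' ?_ (norm_nonneg _) |>.2
    rw [h1, h2]; nlinarith
  · refine abs_le_of_sq_le_sq' ?_ (mul_nonneg (hs.le.trans hsc) hn.le) |>.2
    rw [mul_pow, mul_pow, h1, h2]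
    nlinarith [mul_le_mul_of_nonneg_right (pow_le_pow_left₀ hs.le hsc 2) (sq_nonneg (Real.sinh z.im))]

lemma norm_cot_mem_of_cos_le_sin (z : ℂ) (hc : 0 < Real.cos z.re)
    (hsc : Real.cos z.re ≤ Real.sin z.re) :
    Real.cos z.re / Real.sin z.re ≤ ‖Complex.cos z / Complex.sin z‖ ∧
      ‖Complex.cos z / Complex.sin z‖ ≤ 1 := by
  have h1 := normSq_sin z
  have h2 := normSq_cos z
  have hs := hc.trans_le hsc
  have hn : 0 < ‖Complex.sin z‖ := by
    by_contra hcon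
    have : ‖Complex.sin z‖ = 0 := le_antisymm (not_lt.1 hcon) (norm_nonneg _)
    rw [this] at h1
    nlinarith [sq_nonneg (Real.sinh z.im)]
  rw [norm_div, div_le_one hn, div_le_div_iff₀ hs hn]
  constructor
  · refine abs_le_of_sq_le_sq' ?_ (mul_nonneg (norm_nonneg _) hs.le) |>.2
    rw [mul_pow, mul_pow, h1, h2]
    nlinarith [mul_le_mul_of_nonneg_right (pow_le_pow_left₀ hc.le hsc 2)
      (sq_nonneg (Real.sinh z.im))]
  · refine abs_le_of_sq_le_sq' ?_ (norm_nonneg _) |>.2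
    rw [h1, h2]; nlinarith

lemma sin_mul_cosh_le_norm_sin (z : ℂ) :
    Real.sin z.re * Real.cosh z.im ≤ ‖Complex.sin z‖ := by
  refine abs_le_of_sq_le_sq' ?_ (norm_nonneg _) |>.2
  rw [normSq_sin, mul_pow, Real.cosh_sq]
  nlinarith [Real.sin_sq_le_one z.re, sq_nonneg (Real.sinh z.im)]

lemma sin_pi_mul_pos {α : ℝ} (h0 : 0 < α) (h1 : α < 1) : 0 < Real.sin (Real.pi * α) :=
  Real.sin_pos_of_pos_of_lt_pi (by positivity) (by nlinarith [Real.pi_pos])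

lemma cos_pi_mul_pos {α : ℝ} (h0 : 0 < α) (h1 : α < 1 / 2) : 0 < Real.cos (Real.pi * α) :=
  Real.cos_pos_of_mem_Ioo ⟨by nlinarith [Real.pi_pos], by nlinarith [Real.pi_pos]⟩

lemma pi_mul_re (z : ℂ) : ((Real.pi : ℂ) * z).re = Real.pi * z.re := by simp

lemma pi_mul_im (z : ℂ) : ((Real.pi : ℂ) * z).im = Real.pi * z.im := by simp

lemma sin_ne_zero_of_re {z : ℂ} (h0 : 0 < z.re) (h1 : z.re < 1) :
    Complex.sin (Real.pi * z) ≠ 0 := by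
  rw [← norm_pos_iff]
  refine lt_of_lt_of_le ?_ (sin_mul_cosh_le_norm_sin _)
  rw [pi_mul_re]
  exact mul_pos (sin_pi_mul_pos h0 h1) (Real.cosh_pos _)

lemma cos_ne_zero_of_re {z : ℂ} (h0 : 0 < z.re) (h1 : z.re < 1 / 2) :
    Complex.cos (Real.pi * z) ≠ 0 := by
  intro h
  have h2 := normSq_cos (Real.pi * z)
  rw [h, norm_zero, pi_mul_re] at h2
  nlinarith [cos_pi_mul_pos h0 h1, sq_nonneg (Real.sinh (Real.pi * z : ℂ).im)]

/-- An upper bound for the cotangent on the line `Re z = α`, valid on both sides of `1/4`. -/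
lemma norm_cot_le {α : ℝ} (h0 : 0 < α) (h1 : α < 1 / 2) (ξ : ℝ) :
    ‖Complex.cos (Real.pi * mellinPoint α ξ) / Complex.sin (Real.pi * mellinPoint α ξ)‖ ≤
      (Real.sin (Real.pi * α))⁻¹ := by
  set w := (Real.pi : ℂ) * mellinPoint α ξ
  have hw : w.re = Real.pi * α := by simp [w]
  have hs := sin_pi_mul_pos h0 (by linarith)
  have hc := cos_pi_mul_pos h0 h1
  rw [← one_div]
  rcases le_total (Real.sin (Real.pi * α)) (Real.cos (Real.pi * α)) with h | h
  · refine (norm_cot_mem_of_sin_le_cos w (by rwa [hw]) (by rwa [hw])).2.trans ?_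
    rw [hw]
    gcongr
    exact Real.cos_le_one _
  · refine (norm_cot_mem_of_cos_le_sin w (by rwa [hw]) (by rwa [hw])).2.trans ?_
    rw [one_le_div hs]
    exact Real.sin_le_one _

/-- A lower bound for the cotangent on the line `Re z = α`. -/
lemma cos_le_norm_cot {α : ℝ} (h0 : 0 < α) (h1 : α < 1 / 2) (ξ : ℝ) :
    Real.cos (Real.pi * α) ≤
    ‖Complex.cos (Real.pi * mellinPoint α ξ) / Complex.sin (Real.pi * mellinPoint α ξ)‖ := by
  set w := (Real.pi : ℂ) * mellinPoint α ξ
  have hw : w.re = Real.pi * α := by simp [w]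
  have hs := sin_pi_mul_pos h0 (by linarith)
  have hc := cos_pi_mul_pos h0 h1
  rcases le_total (Real.sin (Real.pi * α)) (Real.cos (Real.pi * α)) with h | h
  · exact (Real.cos_le_one _).trans (norm_cot_mem_of_sin_le_cos w (by rwa [hw]) (by rwa [hw])).1
  · refine le_trans ?_ (norm_cot_mem_of_cos_le_sin w (by rwa [hw]) (by rwa [hw])).1
    rw [hw, le_div_iff₀ hs]
    nlinarith [Real.sin_le_one (Real.pi * α)]

/-- The symbol `cot (π (α - 2πiξ))` of the half-Hilbert transform in logarithmic coordinates. -/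
noncomputable def cotSymbol {α : ℝ} (h0 : 0 < α) (h1 : α < 1 / 2) : ℝ →ᵇ ℂ :=
  BoundedContinuousFunction.ofNormedAddCommGroup
    (fun ξ => Complex.cos (Real.pi * mellinPoint α ξ) / Complex.sin (Real.pi * mellinPoint α ξ))
    (by
      have := continuous_mellinPoint α
      exact Continuous.div (by fun_prop) (by fun_prop)
        fun ξ => sin_ne_zero_of_re (by simpa) (by simp; linarith))
    (Real.sin (Real.pi * α))⁻¹ (norm_cot_le h0 h1)

/-- The reciprocal `tan (π (α - 2πiξ))` of the symbol of the half-Hilbert transform. -/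
noncomputable def tanSymbol {α : ℝ} (h0 : 0 < α) (h1 : α < 1 / 2) : ℝ →ᵇ ℂ :=
  BoundedContinuousFunction.ofNormedAddCommGroup
    (fun ξ => (Complex.cos (Real.pi * mellinPoint α ξ) / Complex.sin (Real.pi * mellinPoint α ξ))⁻¹)
    ((cotSymbol h0 h1).continuous.inv₀ fun ξ => div_ne_zero
      (cos_ne_zero_of_re (by simpa) (by simpa using h1))
      (sin_ne_zero_of_re (by simpa) (by simp; linarith)))
    (Real.cos (Real.pi * α))⁻¹ fun ξ => by
      rw [norm_inv]
      exact inv_anti₀ (cos_pi_mul_pos h0 h1) (cos_le_norm_cot h0 h1 ξ)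

lemma cotSymbol_apply {α : ℝ} (h0 : 0 < α) (h1 : α < 1 / 2) (ξ : ℝ) : cotSymbol h0 h1 ξ =
    Complex.cos (Real.pi * mellinPoint α ξ) / Complex.sin (Real.pi * mellinPoint α ξ) := rfl

lemma cotSymbol_mul_tanSymbol {α : ℝ} (h0 : 0 < α) (h1 : α < 1 / 2) :
    cotSymbol h0 h1 * tanSymbol h0 h1 = 1 := by
  ext ξ
  exact mul_inv_cancel₀ (div_ne_zero (cos_ne_zero_of_re (by simpa) (by simpa using h1))
      (sin_ne_zero_of_re (by simpa) (by simp; linarith)))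

/-- The Fourier transform of an integrable function, as a bounded continuous function. -/
noncomputable def fourierSymbol {K : ℝ → ℂ} (hK : Integrable K) : ℝ →ᵇ ℂ :=
  BoundedContinuousFunction.ofNormedAddCommGroup (𝓕 K)
    (VectorFourier.fourierIntegral_continuous Real.continuous_fourierChar
      (by exact continuous_inner) hK)
    (∫ x, ‖K x‖) (VectorFourier.norm_fourierIntegral_le_integral_norm _ _ _ _)

lemma fourierSymbol_apply {K : ℝ → ℂ} (hK : Integrable K) (ξ : ℝ) :
    fourierSymbol hK ξ = 𝓕 K ξ := rfl

/-! ### Multiplicative convolution operators -/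

/-- The operator on `L²(ℝ₊; x^(2α-1) dx)` that is the Fourier multiplier with symbol `m` in
logarithmic coordinates. -/
noncomputable def mellinMul (α : ℝ) (m : ℝ →ᵇ ℂ) :
    Lp ℂ 2 (halfMeasure α) →L[ℂ] Lp ℂ 2 (halfMeasure α) :=
  ((logCoord α).symm.toContinuousLinearEquiv :
      Lp ℂ 2 (volume : Measure ℝ) →L[ℂ] Lp ℂ 2 (halfMeasure α)) ∘L fourierMul m ∘L
    ((logCoord α).toContinuousLinearEquiv :
      Lp ℂ 2 (halfMeasure α) →L[ℂ] Lp ℂ 2 (volume : Measure ℝ))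

lemma mellinMul_apply (α : ℝ) (m : ℝ →ᵇ ℂ) (f : Lp ℂ 2 (halfMeasure α)) :
    mellinMul α m f = (logCoord α).symm (fourierMul m (logCoord α f)) := rfl

lemma mellinMul_mul (α : ℝ) (m n : ℝ →ᵇ ℂ) (f : Lp ℂ 2 (halfMeasure α)) :
    mellinMul α (m * n) f = mellinMul α m (mellinMul α n f) := by
  simp only [mellinMul_apply, fourierMul_mul, LinearIsometryEquiv.apply_symm_apply]

lemma mellinMul_sub (α : ℝ) (m n : ℝ →ᵇ ℂ) (f : Lp ℂ 2 (halfMeasure α)) :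
    mellinMul α (m - n) f = mellinMul α m f - mellinMul α n f := by
  simp only [mellinMul_apply, fourierMul_sub, map_sub]

lemma mellinMul_one (α : ℝ) (f : Lp ℂ 2 (halfMeasure α)) : mellinMul α 1 f = f := by
  simp only [mellinMul_apply, fourierMul_one, LinearIsometryEquiv.symm_apply_apply]

lemma norm_mellinMul_le (α : ℝ) (m : ℝ →ᵇ ℂ) {C : ℝ} (hm : ∀ ξ, ‖m ξ‖ ≤ C)
    (f : Lp ℂ 2 (halfMeasure α)) : ‖mellinMul α m f‖ ≤ C * ‖f‖ := by
  rw [mellinMul_apply, LinearIsometryEquiv.norm_map, ← (logCoord α).norm_map f]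
  exact norm_fourierMul_le m hm _

lemma le_norm_mellinMul (α : ℝ) (m : ℝ →ᵇ ℂ) {c : ℝ} (hc : 0 < c) (hm : ∀ ξ, c ≤ ‖m ξ‖)
    (f : Lp ℂ 2 (halfMeasure α)) : c * ‖f‖ ≤ ‖mellinMul α m f‖ := by
  rw [mellinMul_apply, LinearIsometryEquiv.norm_map, ← (logCoord α).norm_map f]
  exact le_norm_fourierMul m hc hm _

lemma tendsto_mellinMul {ι : Type*} {l : Filter ι} [l.IsCountablyGenerated] (α : ℝ)
    {m : ι → ℝ →ᵇ ℂ} {m₀ : ℝ →ᵇ ℂ} {C : ℝ}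
    (hC : ∀ᶠ i in l, ∀ ξ, ‖m i ξ‖ ≤ C) (hm : ∀ ξ, Tendsto (fun i => m i ξ) l (𝓝 (m₀ ξ)))
    (f : Lp ℂ 2 (halfMeasure α)) :
    Tendsto (fun i => mellinMul α (m i) f) l (𝓝 (mellinMul α m₀ f)) :=
  ((logCoord α).symm.continuous.tendsto _).comp (tendsto_fourierMul hC hm _)

/-- A kernel that becomes a convolution kernel `K ∈ L¹ ∩ L²` in logarithmic coordinates acts as the
multiplier with symbol `𝓕 K`. -/
lemma mellinMul_eq_integral {α : ℝ} {K : ℝ → ℂ} (hK1 : Integrable K) (hK2 : MemLp K 2)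
    {k : ℝ → ℝ → ℂ}
    (hk : ∀ s u : ℝ, (Real.exp (α * s) : ℂ) * ((Real.exp u : ℂ) * k (Real.exp s) (Real.exp u)) =
      K (s - u) * (Real.exp (α * u) : ℂ)) {m : ℝ →ᵇ ℂ} (hm : ∀ ξ, m ξ = 𝓕 K ξ)
    (f : Lp ℂ 2 (halfMeasure α)) :
    ∀ᵐ x ∂(volume.restrict (Ioi (0 : ℝ))),
      mellinMul α m f x = ∫ t in Ioi 0, k x t * f t := by
  rw [ae_restrict_Ioi_iff_ae_exp]
  have h1 := coeFn_logCoord α (mellinMul α m f)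
  rw [mellinMul_apply, LinearIsometryEquiv.apply_symm_apply] at h1
  filter_upwards [h1, fourierMul_eq_convolution hK1 hK2 m hm (logCoord α f)] with s e1 e2
  have h0 : (Real.exp (α * s) : ℂ) ≠ 0 := by exact_mod_cast (Real.exp_pos _).ne'
  refine mul_left_cancel₀ h0 ?_
  rw [mellinMul_apply, ← e1, e2, integral_Ioi_eq_integral_exp, ← integral_const_mul]
  refine integral_congr_ae ?_
  filter_upwards [coeFn_logCoord α f] with u hu
  rw [hu, ← mul_assoc (K (s - u)), ← hk]
  ring

/-- The kernel of such an operator is square integrable, in the sense needed for the pairing with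
elements of `L²(ℝ₊; x^(2α-1) dx)`. -/
lemma memLp_kernel {α : ℝ} {K : ℝ → ℂ} (hK2 : MemLp K 2) {k : ℝ → ℝ → ℂ}
    (hk : ∀ s u : ℝ, (Real.exp (α * s) : ℂ) * ((Real.exp u : ℂ) * k (Real.exp s) (Real.exp u)) =
      K (s - u) * (Real.exp (α * u) : ℂ)) {x : ℝ} (hx : 0 < x) :
    MemLp (fun t => ((t ^ (1 - 2 * α) : ℝ) : ℂ) * k x t) 2 (halfMeasure α) := by
  rw [memLp_two_halfMeasure_iff]
  have h := (hK2.comp_measurePreserving (volume.measurePreserving_sub_left (Real.log x))).const_mul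
    (Real.exp (-(α * Real.log x)) : ℂ)
  refine (memLp_congr_ae (Eventually.of_forall fun u => ?_)).1 h
  have h2 := hk (Real.log x) u
  rw [Real.exp_log hx] at h2
  have e1 : (Real.exp (α * u) : ℂ) * ((Real.exp u ^ (1 - 2 * α) : ℝ) : ℂ) =
      (Real.exp u : ℂ) * (Real.exp (-(α * u)) : ℂ) := by
    rw [← Real.exp_mul, ← Complex.ofReal_mul, ← Complex.ofReal_mul, ← Real.exp_add, ← Real.exp_add]
    congr 2; ring
  have e2 : ∀ v : ℝ, (Real.exp (-v) : ℂ) * (Real.exp v : ℂ) = 1 := fun v => by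
    rw [← Complex.ofReal_mul, ← Real.exp_add]; simp
  simp only [Function.comp_apply]
  rw [← mul_assoc, e1]
  linear_combination (-(Real.exp (-(α * Real.log x)) : ℂ) * Real.exp (-(α * u))) * h2 +
    ((Real.exp u : ℂ) * Real.exp (-(α * u)) * k x (Real.exp u)) * e2 (α * Real.log x) -
    (Real.exp (-(α * Real.log x)) : ℂ) * K (Real.log x - u) * e2 (α * u)

/-! ### The logistic kernel -/

lemma memLp_two_of_integrable_of_bound {K : ℝ → ℂ} (hK : Integrable K) {C : ℝ}
    (hC : ∀ r, ‖K r‖ ≤ C) : MemLp K 2 := by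
  rw [memLp_two_iff_integrable_sq_norm hK.aestronglyMeasurable]
  refine (hK.norm.const_mul C).mono' (hK.aestronglyMeasurable.norm.pow 2)
    (Eventually.of_forall fun r => ?_)
  rw [norm_pow, norm_norm, sq]
  exact mul_le_mul_of_nonneg_right (hC r) (norm_nonneg _)

lemma rexp_div_one_add_rexp_le_one {a : ℝ} (h0 : 0 ≤ a) (h1 : a ≤ 1) (r : ℝ) :
    Real.exp (a * r) / (1 + Real.exp r) ≤ 1 := by
  rw [div_le_one (by positivity)]
  rcases le_total r 0 with hr | hr
  · have : Real.exp (a * r) ≤ 1 := Real.exp_le_one_iff.2 (mul_nonpos_of_nonneg_of_nonpos h0 hr)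
    linarith [Real.exp_pos r]
  · have : Real.exp (a * r) ≤ Real.exp r := Real.exp_le_exp.2 (by nlinarith)
    linarith

/-- The convolution kernel `e^(αr) / (1 + e^(r+ℓ))` of the Cauchy-type kernel `1 / (t + e^ℓ x)`. -/
noncomputable def logisticKernel (α : ℝ) (ℓ : ℂ) (r : ℝ) : ℂ :=
  Complex.exp ((α : ℂ) * r) / (1 + Complex.exp (r + ℓ))

section logisticKernel

variable {α : ℝ} {ℓ : ℂ}

lemma integrable_logisticKernel (h0 : 0 < α) (h1 : α < 1) (hℓ : |ℓ.im| < Real.pi) :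
    Integrable (logisticKernel α ℓ) :=
  integrable_shifted_kernel (z := α) (by simpa) (by simpa) hℓ

lemma memLp_logisticKernel (h0 : 0 < α) (h1 : α < 1) (hℓ : |ℓ.im| < Real.pi) :
    MemLp (logisticKernel α ℓ) 2 := by
  obtain ⟨C, hC0, hC⟩ := exists_norm_shifted_kernel_le hℓ
  refine memLp_two_of_integrable_of_bound (integrable_logisticKernel h0 h1 hℓ) (C := C) fun r => ?_
  refine (hC α r).trans ?_
  rw [Complex.ofReal_re]
  exact mul_le_of_le_one_right hC0.le (rexp_div_one_add_rexp_le_one h0.le h1.le r)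

lemma cexp_neg_two_pi_mul (α ξ v : ℝ) :
    Complex.exp ((-2 * Real.pi * v * ξ : ℝ) * Complex.I) * Complex.exp ((α : ℂ) * v) =
      Complex.exp (mellinPoint α ξ * v) := by
  rw [← Complex.exp_add, mellinPoint]
  congr 1
  push_cast
  ring

lemma fourier_logisticKernel (h0 : 0 < α) (h1 : α < 1) (hℓ : |ℓ.im| < Real.pi) (ξ : ℝ) :
    𝓕 (logisticKernel α ℓ) ξ = Complex.exp (-(mellinPoint α ξ * ℓ)) *
      (Real.pi / Complex.sin (Real.pi * mellinPoint α ξ)) := by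
  rw [Real.fourier_real_eq_integral_exp_smul,
    ← integral_shifted_kernel (by simpa) (by simpa) hℓ]
  refine integral_congr_ae (Eventually.of_forall fun v => ?_)
  simp only [smul_eq_mul, logisticKernel]
  rw [← mul_div_assoc, cexp_neg_two_pi_mul]

end logisticKernel

/-! ### The Stieltjes-type operator of the inversion formula -/

/-- The kernel `(1/π) / ((√x + √t) √t)` in logarithmic coordinates. -/
noncomputable def sqrtKernel (α : ℝ) (r : ℝ) : ℂ :=
  (1 / (Real.pi : ℂ)) * (Complex.exp (((2 * α : ℝ) : ℂ) * ((r / 2 : ℝ) : ℂ)) /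
    (1 + Complex.exp ((r / 2 : ℝ) : ℂ)))

section sqrtKernel

variable {α : ℝ}

lemma integrable_sqrtKernel (h0 : 0 < α) (h1 : α < 1 / 2) : Integrable (sqrtKernel α) :=
  ((integrable_exp_div_one_add_exp (z := (2 * α : ℝ)) (by simpa) (by
    rw [Complex.ofReal_re]; linarith)).comp_div two_ne_zero).const_mul _

lemma memLp_sqrtKernel (h0 : 0 < α) (h1 : α < 1 / 2) : MemLp (sqrtKernel α) 2 := by
  refine memLp_two_of_integrable_of_bound (integrable_sqrtKernel h0 h1)
    (C := ‖1 / (Real.pi : ℂ)‖) fun r => ?_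
  rw [sqrtKernel, norm_mul]
  refine mul_le_of_le_one_right (norm_nonneg _) ?_
  have : Complex.exp (((2 * α : ℝ) : ℂ) * ((r / 2 : ℝ) : ℂ)) / (1 + Complex.exp ((r / 2 : ℝ) : ℂ)) =
      ((Real.exp (2 * α * (r / 2)) / (1 + Real.exp (r / 2)) : ℝ) : ℂ) := by push_cast; rfl
  rw [this, Complex.norm_real, Real.norm_of_nonneg (by positivity)]
  exact rexp_div_one_add_rexp_le_one (by linarith) (by linarith) _

lemma fourier_sqrtKernel (h0 : 0 < α) (h1 : α < 1 / 2) (ξ : ℝ) :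
    𝓕 (sqrtKernel α) ξ = 2 / Complex.sin (2 * (Real.pi * mellinPoint α ξ)) := by
  have hz : (2 * mellinPoint α ξ).re = 2 * α := by simp
  have h := integral_exp_div_one_add_exp (z := 2 * mellinPoint α ξ) (by rw [hz]; linarith)
    (by rw [hz]; linarith)
  have h2 := Measure.integral_comp_div
    (fun r : ℝ => Complex.exp (2 * mellinPoint α ξ * r) / (1 + Complex.exp r)) 2
  rw [h, abs_two] at h2
  have hπ : (Real.pi : ℂ) ≠ 0 := by exact_mod_cast Real.pi_ne_zero
  have h3 : 𝓕 (sqrtKernel α) ξ = (1 / (Real.pi : ℂ)) * ∫ r : ℝ,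
      Complex.exp (2 * mellinPoint α ξ * ((r / 2 : ℝ) : ℂ)) / (1 + Complex.exp ((r / 2 : ℝ) : ℂ)) := by
    rw [Real.fourier_real_eq_integral_exp_smul, ← integral_const_mul]
    refine integral_congr_ae (Eventually.of_forall fun v => ?_)
    simp only [smul_eq_mul, sqrtKernel]
    have e1 : ((2 * α : ℝ) : ℂ) * ((v / 2 : ℝ) : ℂ) = (α : ℂ) * v := by push_cast; ring
    have e2 : 2 * mellinPoint α ξ * ((v / 2 : ℝ) : ℂ) = mellinPoint α ξ * v := by push_cast; ring
    rw [e1, e2, ← cexp_neg_two_pi_mul]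
    ring
  rw [h3, h2, Complex.real_smul]
  have e3 : (Real.pi : ℂ) * (2 * mellinPoint α ξ) = 2 * (Real.pi * mellinPoint α ξ) := by ring
  rw [e3]
  push_cast
  field_simp

lemma sqrtKernel_spec (α s u : ℝ) :
    (Real.exp (α * s) : ℂ) * ((Real.exp u : ℂ) * ((1 / (Real.pi : ℂ)) *
      (((√(Real.exp s) + √(Real.exp u)) * √(Real.exp u) : ℝ) : ℂ)⁻¹)) =
      sqrtKernel α (s - u) * (Real.exp (α * u) : ℂ) := by
  have hs : ∀ v : ℝ, √(Real.exp v) = Real.exp (v / 2) := fun v => (Real.exp_half v).symm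
  have e1 : Complex.exp (((2 * α : ℝ) : ℂ) * (((s - u) / 2 : ℝ) : ℂ)) =
      ((Real.exp (α * s) * (Real.exp (α * u))⁻¹ : ℝ) : ℂ) := by
    rw [← Real.exp_neg, ← Real.exp_add, ← Complex.ofReal_mul, ← Complex.ofReal_exp]
    congr 2; ring
  have e2 : (1 : ℂ) + Complex.exp (((s - u) / 2 : ℝ) : ℂ) =
      ((1 + Real.exp (s / 2) * (Real.exp (u / 2))⁻¹ : ℝ) : ℂ) := by
    rw [← Real.exp_neg, ← Real.exp_add, ← Complex.ofReal_exp]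
    push_cast
    congr 2; ring
  have e3 : Real.exp u = Real.exp (u / 2) * Real.exp (u / 2) := by
    rw [← Real.exp_add]; congr 1; ring
  rw [sqrtKernel, e1, e2, hs, hs, e3]
  have key : Real.exp (α * s) * (Real.exp (u / 2) * Real.exp (u / 2) * ((1 / Real.pi) *
      ((Real.exp (s / 2) + Real.exp (u / 2)) * Real.exp (u / 2))⁻¹)) =
      (1 / Real.pi) * (Real.exp (α * s) * (Real.exp (α * u))⁻¹ /
        (1 + Real.exp (s / 2) * (Real.exp (u / 2))⁻¹)) * Real.exp (α * u) := by
    have := Real.exp_pos (s / 2); have := Real.exp_pos (u / 2); have := Real.exp_pos (α * u)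
    have := Real.pi_pos
    field_simp
    ring
  have := congrArg (fun x : ℝ => (x : ℂ)) key
  push_cast at this ⊢
  exact this

end sqrtKernel

/-! ### The conjugate Poisson kernel -/

/-- The principal logarithm of `-1 + iτ`; at `±τ` these are the logarithms of the two factors
`t + e^ℓ x` of `(t - x)² + τ²x²`, and they tend to `±iπ` as `τ → 0+`. -/
noncomputable def poissonLog (τ : ℝ) : ℂ := Complex.log (-1 + (τ : ℂ) * Complex.I)

lemma re_poissonLog_nonneg (τ : ℝ) : 0 ≤ (poissonLog τ).re := by
  rw [poissonLog, Complex.log_re]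
  refine Real.log_nonneg ?_
  have := Complex.abs_re_le_norm (-1 + (τ : ℂ) * Complex.I)
  simpa using this

lemma abs_im_poissonLog_lt {τ : ℝ} (hτ : τ ≠ 0) : |(poissonLog τ).im| < Real.pi := by
  rw [poissonLog, Complex.log_im, abs_lt]
  exact ⟨Complex.neg_pi_lt_arg _, Complex.arg_lt_pi_iff.2 (Or.inr (by simpa using hτ))⟩

lemma exp_poissonLog (τ : ℝ) : Complex.exp (poissonLog τ) = -1 + (τ : ℂ) * Complex.I := by
  refine Complex.exp_log fun h => ?_
  have := congrArg Complex.re h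
  simp at this

lemma tendsto_poissonLog_pos : Tendsto poissonLog (𝓝[>] 0) (𝓝 (Real.pi * Complex.I)) := by
  have h := Complex.tendsto_log_nhdsWithin_im_nonneg_of_re_neg_of_im_zero (z := -1) (by simp) (by simp)
  simp only [norm_neg, norm_one, Real.log_one, Complex.ofReal_zero, zero_add] at h
  refine h.comp (tendsto_nhdsWithin_of_tendsto_nhds_of_eventually_within _ ?_ ?_)
  · exact (Continuous.tendsto' (by fun_prop) 0 _ (by simp)).mono_left nhdsWithin_le_nhds
  · filter_upwards [self_mem_nhdsWithin] with τ hτ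
    simpa using le_of_lt hτ

lemma tendsto_poissonLog_neg :
    Tendsto (fun τ => poissonLog (-τ)) (𝓝[>] 0) (𝓝 (-(Real.pi * Complex.I))) := by
  have h := Complex.tendsto_log_nhdsWithin_im_neg_of_re_neg_of_im_zero (z := -1) (by simp) (by simp)
  simp only [norm_neg, norm_one, Real.log_one, Complex.ofReal_zero, zero_sub] at h
  refine h.comp (tendsto_nhdsWithin_of_tendsto_nhds_of_eventually_within _ ?_ ?_)
  · exact (Continuous.tendsto' (by fun_prop) 0 _ (by simp)).mono_left nhdsWithin_le_nhds
  · filter_upwards [self_mem_nhdsWithin] with τ hτ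
    simpa using hτ

/-- The kernel `(1/π) (t - x) / ((t - x)² + τ²x²)` in logarithmic coordinates. -/
noncomputable def conjPoissonKernel (α τ r : ℝ) : ℂ :=
  (1 / (2 * Real.pi) : ℂ) * (logisticKernel α (poissonLog τ) r +
    logisticKernel α (poissonLog (-τ)) r)

section conjPoissonKernel

variable {α τ : ℝ}

lemma integrable_conjPoissonKernel (h0 : 0 < α) (h1 : α < 1) (hτ : τ ≠ 0) :
    Integrable (conjPoissonKernel α τ) :=
  ((integrable_logisticKernel h0 h1 (abs_im_poissonLog_lt hτ)).add
    (integrable_logisticKernel h0 h1 (abs_im_poissonLog_lt (neg_ne_zero.2 hτ)))).const_mul _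

lemma memLp_conjPoissonKernel (h0 : 0 < α) (h1 : α < 1) (hτ : τ ≠ 0) :
    MemLp (conjPoissonKernel α τ) 2 :=
  ((memLp_logisticKernel h0 h1 (abs_im_poissonLog_lt hτ)).add
    (memLp_logisticKernel h0 h1 (abs_im_poissonLog_lt (neg_ne_zero.2 hτ)))).const_mul _

lemma fourier_conjPoissonKernel (h0 : 0 < α) (h1 : α < 1) (hτ : τ ≠ 0) (ξ : ℝ) :
    𝓕 (conjPoissonKernel α τ) ξ =
      (Complex.exp (-(mellinPoint α ξ * poissonLog τ)) +
        Complex.exp (-(mellinPoint α ξ * poissonLog (-τ)))) /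
        (2 * Complex.sin (Real.pi * mellinPoint α ξ)) := by
  have hτ' := neg_ne_zero.2 hτ
  have h2 : 𝓕 (conjPoissonKernel α τ) ξ = (1 / (2 * Real.pi) : ℂ) *
      (𝓕 (logisticKernel α (poissonLog τ)) ξ + 𝓕 (logisticKernel α (poissonLog (-τ))) ξ) := by
    simp only [Real.fourier_eq]
    rw [← integral_add, ← integral_const_mul]
    · refine integral_congr_ae (Eventually.of_forall fun v => ?_)
      simp only [conjPoissonKernel, Circle.smul_def, smul_eq_mul]
      ring
    · exact (Real.fourierIntegral_convergent_iff _).2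
        (integrable_logisticKernel h0 h1 (abs_im_poissonLog_lt hτ))
    · exact (Real.fourierIntegral_convergent_iff _).2
        (integrable_logisticKernel h0 h1 (abs_im_poissonLog_lt hτ'))
  have hπ : (Real.pi : ℂ) ≠ 0 := by exact_mod_cast Real.pi_ne_zero
  rw [h2, fourier_logisticKernel h0 h1 (abs_im_poissonLog_lt hτ),
    fourier_logisticKernel h0 h1 (abs_im_poissonLog_lt hτ')]
  field_simp

lemma norm_exp_neg_mellinPoint_mul_le (h0 : 0 < α) (ξ τ : ℝ) :
    ‖Complex.exp (-(mellinPoint α ξ * poissonLog τ))‖ ≤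
      2 * Real.cosh (Real.pi * mellinPoint α ξ : ℂ).im := by
  rw [Complex.norm_exp, pi_mul_im]
  set y := (mellinPoint α ξ).im
  have h1 : (-(mellinPoint α ξ * poissonLog τ)).re ≤ |Real.pi * y| := by
    rw [Complex.neg_re, Complex.mul_re, mellinPoint_re]
    have e1 := mul_nonneg h0.le (re_poissonLog_nonneg τ)
    have e2 : y * (poissonLog τ).im ≤ |Real.pi * y| := by
      refine (le_abs_self _).trans ?_
      rw [abs_mul, abs_mul, abs_of_pos Real.pi_pos, mul_comm]
      refine mul_le_mul_of_nonneg_right ?_ (abs_nonneg _)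
      rw [poissonLog, Complex.log_im]
      exact Complex.abs_arg_le_pi _
    linarith
  refine (Real.exp_le_exp.2 h1).trans ?_
  rw [← Real.cosh_abs, Real.cosh_eq]
  linarith [Real.exp_pos (-|Real.pi * y|)]

lemma norm_fourier_conjPoissonKernel_le (h0 : 0 < α) (h1 : α < 1) (hτ : τ ≠ 0) (ξ : ℝ) :
    ‖𝓕 (conjPoissonKernel α τ) ξ‖ ≤ 2 / Real.sin (Real.pi * α) := by
  have hs := sin_pi_mul_pos h0 h1
  have h2 := sin_mul_cosh_le_norm_sin (Real.pi * mellinPoint α ξ)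
  rw [pi_mul_re, mellinPoint_re] at h2
  have hc := Real.cosh_pos (Real.pi * mellinPoint α ξ : ℂ).im
  have h3 : 0 < ‖Complex.sin (Real.pi * mellinPoint α ξ)‖ := (mul_pos hs hc).trans_le h2
  rw [fourier_conjPoissonKernel h0 h1 hτ, norm_div, norm_mul, Complex.norm_two,
    div_le_div_iff₀ (by positivity) hs]
  have h4 := norm_add_le (Complex.exp (-(mellinPoint α ξ * poissonLog τ)))
    (Complex.exp (-(mellinPoint α ξ * poissonLog (-τ))))
  have h5 := norm_exp_neg_mellinPoint_mul_le h0 ξ τ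
  have h6 := norm_exp_neg_mellinPoint_mul_le h0 ξ (-τ)
  nlinarith [mul_le_mul_of_nonneg_right (h4.trans (add_le_add h5 h6)) hs.le]

lemma tendsto_fourier_conjPoissonKernel (h0 : 0 < α) (h1 : α < 1) (ξ : ℝ) :
    Tendsto (fun τ => 𝓕 (conjPoissonKernel α τ) ξ) (𝓝[>] 0)
      (𝓝 (Complex.cos (Real.pi * mellinPoint α ξ) / Complex.sin (Real.pi * mellinPoint α ξ))) := by
  have e := (((tendsto_poissonLog_pos.const_mul (mellinPoint α ξ)).neg.cexp).add
    ((tendsto_poissonLog_neg.const_mul (mellinPoint α ξ)).neg.cexp)).div_const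
      (2 * Complex.sin (Real.pi * mellinPoint α ξ))
  have h2 : (Complex.exp (-(mellinPoint α ξ * (Real.pi * Complex.I))) +
      Complex.exp (-(mellinPoint α ξ * -(Real.pi * Complex.I)))) /
        (2 * Complex.sin (Real.pi * mellinPoint α ξ)) =
      Complex.cos (Real.pi * mellinPoint α ξ) / Complex.sin (Real.pi * mellinPoint α ξ) := by
    rw [Complex.cos, div_div, add_comm]
    congr 3 <;> ring_nf
  rw [h2] at e
  refine e.congr' ?_
  filter_upwards [self_mem_nhdsWithin] with τ hτ
  rw [fourier_conjPoissonKernel h0 h1 (ne_of_gt hτ)]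

lemma conjPoissonKernel_spec (hτ : τ ≠ 0) (s u : ℝ) :
    (Real.exp (α * s) : ℂ) * ((Real.exp u : ℂ) * ((1 / (Real.pi : ℂ)) *
      (((Real.exp u - Real.exp s) / ((Real.exp u - Real.exp s) ^ 2 + (τ * Real.exp s) ^ 2) : ℝ) : ℂ))) =
      conjPoissonKernel α τ (s - u) * (Real.exp (α * u) : ℂ) := by
  have e1 : Complex.exp ((α : ℂ) * ((s - u : ℝ) : ℂ)) = (Real.exp (α * s) : ℂ) / (Real.exp (α * u) : ℂ) := by
    rw [← Complex.ofReal_div, ← Real.exp_sub, ← Complex.ofReal_mul, ← Complex.ofReal_exp]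
    congr 2; ring
  have e2 : Complex.exp (((s - u : ℝ) : ℂ)) = (Real.exp s : ℂ) / (Real.exp u : ℂ) := by
    rw [← Complex.ofReal_div, ← Real.exp_sub, ← Complex.ofReal_exp]
  rw [conjPoissonKernel, logisticKernel, logisticKernel, Complex.exp_add, Complex.exp_add,
    exp_poissonLog, exp_poissonLog, e1, e2]
  have hX := Real.exp_pos s
  have hT := Real.exp_pos u
  have hA := Real.exp_pos (α * u)
  generalize Real.exp s = X at *
  generalize Real.exp u = T at *
  generalize Real.exp (α * u) = A at *
  generalize Real.exp (α * s) = B at *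
  have hq : ((T - X) ^ 2 + (τ * X) ^ 2) ≠ 0 := by
    have := mul_ne_zero hτ hX.ne'
    positivity
  have hT0 : (T : ℂ) ≠ 0 := by exact_mod_cast hT.ne'
  have hA0 : (A : ℂ) ≠ 0 := by exact_mod_cast hA.ne'
  have hπ : (Real.pi : ℂ) ≠ 0 := by exact_mod_cast Real.pi_ne_zero
  have hfac : (((T - X) ^ 2 + (τ * X) ^ 2 : ℝ) : ℂ) =
      (T + X * (-1 + τ * Complex.I)) * (T + X * (-1 - τ * Complex.I)) := by
    push_cast
    linear_combination ((τ : ℂ) ^ 2 * X ^ 2) * Complex.I_sq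
  have hq' : (T + X * (-1 + τ * Complex.I)) * (T + X * (-1 - τ * Complex.I)) ≠ 0 := by
    rw [← hfac]; exact_mod_cast hq
  have h1 := left_ne_zero_of_mul hq'
  have h2 := right_ne_zero_of_mul hq'
  rw [Complex.ofReal_div, hfac]
  have d1 : (1 : ℂ) + X / T * (-1 + τ * Complex.I) = (T + X * (-1 + τ * Complex.I)) / T := by
    field_simp
  have d2 : (1 : ℂ) + X / T * (-1 + ((-τ : ℝ) : ℂ) * Complex.I) = (T + X * (-1 - τ * Complex.I)) / T := by
    push_cast; field_simp; ring
  rw [d1, d2]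
  push_cast
  field_simp
  ring

end conjPoissonKernel

/-! ### The half-Hilbert transform as a Mellin multiplier -/

/-- The half-Hilbert transform on `L²(ℝ₊; x^(2α-1) dx)`, defined as the Mellin multiplier with
symbol `cot (π (α - 2πiξ))`. -/
noncomputable def halfHilbert {α : ℝ} (h0 : 0 < α) (h1 : α < 1 / 2) :
    Lp ℂ 2 (halfMeasure α) ≃L[ℂ] Lp ℂ 2 (halfMeasure α) :=
  ContinuousLinearEquiv.equivOfInverse (mellinMul α (cotSymbol h0 h1))
    (mellinMul α (tanSymbol h0 h1))
    (fun f => by rw [← mellinMul_mul, mul_comm, cotSymbol_mul_tanSymbol, mellinMul_one])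
    (fun f => by rw [← mellinMul_mul, cotSymbol_mul_tanSymbol, mellinMul_one])

section halfHilbert

variable {α : ℝ} (h0 : 0 < α) (h1 : α < 1 / 2)

lemma halfHilbert_apply (f : Lp ℂ 2 (halfMeasure α)) :
    halfHilbert h0 h1 f = mellinMul α (cotSymbol h0 h1) f := rfl

lemma ae_restrict_Ioi_iff_ae_halfMeasure {p : ℝ → Prop} :
    (∀ᵐ x ∂(volume.restrict (Ioi (0 : ℝ))), p x) ↔ ∀ᵐ x ∂(halfMeasure α), p x := by
  rw [ae_restrict_Ioi_iff_ae_exp, ae_halfMeasure_iff_ae_exp]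

lemma aestronglyMeasurable_restrict_Ioi (f : Lp ℂ 2 (halfMeasure α)) :
    AEStronglyMeasurable f (volume.restrict (Ioi 0)) :=
  (Lp.aestronglyMeasurable f).mono_ac fun _ hA => measure_eq_zero_iff_ae_notMem.2
    (ae_restrict_Ioi_iff_ae_halfMeasure.2 (measure_eq_zero_iff_ae_notMem.1 hA))

lemma integrableOn_conjPoisson_mul (h0 : 0 < α) (h1 : α < 1) (f : Lp ℂ 2 (halfMeasure α))
    {x : ℝ} (hx : 0 < x) {δ : ℝ} (hδ : 0 < δ) :
    IntegrableOn (fun t => (((t - x) / ((t - x) ^ 2 + δ ^ 2) : ℝ) : ℂ) * f t) (Ioi 0) := by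
  have hτ : δ / x ≠ 0 := (div_pos hδ hx).ne'
  have h := integrableOn_mul_of_memLp (memLp_kernel (α := α)
    (k := fun y t => (1 / (Real.pi : ℂ)) * (((t - y) / ((t - y) ^ 2 + (δ / x * y) ^ 2) : ℝ) : ℂ))
    (memLp_conjPoissonKernel h0 h1 hτ) (conjPoissonKernel_spec hτ) hx) f
  rw [div_mul_cancel₀ _ hx.ne'] at h
  refine (h.const_mul (Real.pi : ℂ)).congr (Eventually.of_forall fun t => ?_)
  have hπ : (Real.pi : ℂ) ≠ 0 := by exact_mod_cast Real.pi_ne_zero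
  simp only
  field_simp

/-- If the principal values exist almost everywhere, they give the half-Hilbert transform. -/
lemma halfHilbert_ae_eq_of_hasHalfHilbert (f : Lp ℂ 2 (halfMeasure α)) (g : ℝ → ℂ)
    (h : HasHalfHilbert f g) :
    ∀ᵐ x ∂(volume.restrict (Ioi (0 : ℝ))), halfHilbert h0 h1 f x = g x := by
  have h1' : α < 1 := by linarith
  let τ : ℕ → ℝ := fun n => 1 / ((n : ℝ) + 1)
  have hτpos : ∀ n, 0 < τ n := fun n => by positivity
  have hτlim : Tendsto τ atTop (𝓝[>] 0) :=
    tendsto_nhdsWithin_of_tendsto_nhds_of_eventually_within _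
      tendsto_one_div_add_atTop_nhds_zero_nat (Eventually.of_forall hτpos)
  let m : ℕ → ℝ →ᵇ ℂ := fun n => fourierSymbol (integrable_conjPoissonKernel h0 h1' (hτpos n).ne')
  have hconv : Tendsto (fun n => mellinMul α (m n) f) atTop (𝓝 (halfHilbert h0 h1 f)) :=
    tendsto_mellinMul α (C := 2 / Real.sin (Real.pi * α))
      (Eventually.of_forall fun n ξ => norm_fourier_conjPoissonKernel_le h0 h1' (hτpos n).ne' ξ)
      (fun ξ => (tendsto_fourier_conjPoissonKernel h0 h1' ξ).comp hτlim) f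
  obtain ⟨ns, hns, hae⟩ := (tendstoInMeasure_of_tendsto_Lp hconv).exists_seq_tendsto_ae
  have hker : ∀ᵐ x ∂(volume.restrict (Ioi (0 : ℝ))), ∀ n, mellinMul α (m n) f x =
      ∫ t in Ioi 0, ((1 / (Real.pi : ℂ)) *
        (((t - x) / ((t - x) ^ 2 + (τ n * x) ^ 2) : ℝ) : ℂ)) * f t :=
    ae_all_iff.2 fun n => mellinMul_eq_integral
      (k := fun x t => (1 / (Real.pi : ℂ)) *
        (((t - x) / ((t - x) ^ 2 + (τ n * x) ^ 2) : ℝ) : ℂ))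
      (integrable_conjPoissonKernel h0 h1' (hτpos n).ne')
      (memLp_conjPoissonKernel h0 h1' (hτpos n).ne') (conjPoissonKernel_spec (hτpos n).ne')
      (fun ξ => rfl) f
  filter_upwards [ae_restrict_Ioi_iff_ae_halfMeasure.2 hae, hker, h,
    ae_restrict_mem measurableSet_Ioi] with x hx1 hx2 hx3 hx4
  have hx : 0 < x := hx4
  refine tendsto_nhds_unique hx1 ?_
  have hδ : Tendsto (fun n => τ (ns n) * x) atTop (𝓝[>] 0) := by
    refine tendsto_nhdsWithin_of_tendsto_nhds_of_eventually_within _ ?_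
      (Eventually.of_forall fun n => mul_pos (hτpos _) hx)
    simpa using ((hτlim.mono_right nhdsWithin_le_nhds).comp hns.tendsto_atTop).mul_const x
  refine ((hx3.tendsto_conjPoisson (aestronglyMeasurable_restrict_Ioi f)
    (fun δ hδ => integrableOn_conjPoisson_mul h0 h1' f hx hδ)).comp hδ).congr fun n => ?_
  simp only [Function.comp_apply]
  rw [hx2, ← integral_const_mul]
  simp only [mul_assoc]

lemma integrableOn_sqrt_kernel (h0 : 0 < α) (h1 : α < 1 / 2) (f : Lp ℂ 2 (halfMeasure α))
    {x : ℝ} (hx : 0 < x) :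
    IntegrableOn (fun t : ℝ => f t / (((√x + √t) * √t : ℝ) : ℂ)) (Ioi (0 : ℝ)) := by
  have h := integrableOn_mul_of_memLp (memLp_kernel (α := α)
    (k := fun x t => (1 / (Real.pi : ℂ)) * (((√x + √t) * √t : ℝ) : ℂ)⁻¹)
    (memLp_sqrtKernel h0 h1) (sqrtKernel_spec α) hx) f
  refine (h.const_mul (Real.pi : ℂ)).congr (Eventually.of_forall fun t => ?_)
  have hπ : (Real.pi : ℂ) ≠ 0 := by exact_mod_cast Real.pi_ne_zero
  simp only
  rw [div_eq_mul_inv]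
  field_simp

/-- The inversion formula: `2 / sin 2w · cot w - cot² w = 1` at the level of symbols. -/
lemma halfHilbert_inversion (f : Lp ℂ 2 (halfMeasure α)) :
    ∀ᵐ x ∂(volume.restrict (Ioi (0 : ℝ))), f x = (1 / (Real.pi : ℂ)) *
      (∫ t in Ioi (0 : ℝ), halfHilbert h0 h1 f t / (((√x + √t) * √t : ℝ) : ℂ)) -
        halfHilbert h0 h1 (halfHilbert h0 h1 f) x := by
  let σ := fourierSymbol (integrable_sqrtKernel h0 h1)
  have hsym : σ * cotSymbol h0 h1 - cotSymbol h0 h1 * cotSymbol h0 h1 = 1 := by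
    ext ξ
    simp only [BoundedContinuousFunction.coe_sub, BoundedContinuousFunction.coe_mul, Pi.sub_apply,
      Pi.mul_apply, cotSymbol_apply, σ, fourierSymbol_apply, fourier_sqrtKernel h0 h1,
      BoundedContinuousFunction.coe_one, Pi.one_apply, Complex.sin_two_mul]
    have hs := sin_ne_zero_of_re (z := mellinPoint α ξ) (by simpa) (by simp; linarith)
    have hc := cos_ne_zero_of_re (z := mellinPoint α ξ) (by simpa) (by simpa using h1)
    have := Complex.sin_sq_add_cos_sq (Real.pi * mellinPoint α ξ)
    generalize Complex.sin (Real.pi * mellinPoint α ξ) = S at *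
    generalize Complex.cos (Real.pi * mellinPoint α ξ) = C at *
    field_simp
    linear_combination -this
  have hop : f = mellinMul α σ (halfHilbert h0 h1 f) - halfHilbert h0 h1 (halfHilbert h0 h1 f) := by
    simp only [halfHilbert_apply]
    rw [← mellinMul_mul, ← mellinMul_mul, ← mellinMul_sub, hsym, mellinMul_one]
  have hker := mellinMul_eq_integral (α := α)
    (k := fun x t => (1 / (Real.pi : ℂ)) * (((√x + √t) * √t : ℝ) : ℂ)⁻¹)
    (integrable_sqrtKernel h0 h1) (memLp_sqrtKernel h0 h1) (sqrtKernel_spec α)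
    (m := σ) (fun ξ => rfl) (halfHilbert h0 h1 f)
  have hsub := ae_restrict_Ioi_iff_ae_halfMeasure.2
    (Lp.coeFn_sub (mellinMul α σ (halfHilbert h0 h1 f)) (halfHilbert h0 h1 (halfHilbert h0 h1 f)))
  rw [← hop] at hsub
  filter_upwards [hker, hsub] with x e1 e2
  rw [e2, Pi.sub_apply, e1, ← integral_const_mul]
  simp only [div_eq_mul_inv, mul_assoc, mul_comm]

lemma norm_halfHilbert_of_le (hα : α ≤ 1 / 4) (f : Lp ℂ 2 (halfMeasure α)) :
    ‖f‖ ≤ ‖halfHilbert h0 h1 f‖ ∧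
      ‖halfHilbert h0 h1 f‖ ≤ Real.cot (Real.pi * α) * ‖f‖ := by
  have hs := sin_pi_mul_pos h0 (by linarith)
  have hsc : Real.sin (Real.pi * α) ≤ Real.cos (Real.pi * α) := by
    rw [← Real.sin_pi_div_two_sub]
    exact Real.sin_le_sin_of_le_of_le_pi_div_two (by nlinarith [Real.pi_pos])
      (by nlinarith [Real.pi_pos]) (by nlinarith [Real.pi_pos])
  have key := fun ξ => norm_cot_mem_of_sin_le_cos (Real.pi * mellinPoint α ξ)
    (by simpa using hs) (by simpa using hsc)
  simp only [pi_mul_re, mellinPoint_re] at key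
  constructor
  · rw [halfHilbert_apply]
    simpa using le_norm_mellinMul α (cotSymbol h0 h1) one_pos (fun ξ => (key ξ).1) f
  · rw [Real.cot_eq_cos_div_sin]
    exact norm_mellinMul_le α (cotSymbol h0 h1) (fun ξ => (key ξ).2) f

lemma norm_halfHilbert_of_ge (hα : 1 / 4 ≤ α) (f : Lp ℂ 2 (halfMeasure α)) :
    Real.cot (Real.pi * α) * ‖f‖ ≤ ‖halfHilbert h0 h1 f‖ ∧
      ‖halfHilbert h0 h1 f‖ ≤ ‖f‖ := by
  have hs := sin_pi_mul_pos h0 (by linarith)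
  have hc := cos_pi_mul_pos h0 h1
  have hsc : Real.cos (Real.pi * α) ≤ Real.sin (Real.pi * α) := by
    rw [← Real.sin_pi_div_two_sub]
    exact Real.sin_le_sin_of_le_of_le_pi_div_two (by nlinarith [Real.pi_pos])
      (by nlinarith [Real.pi_pos]) (by nlinarith [Real.pi_pos])
  have key := fun ξ => norm_cot_mem_of_cos_le_sin (Real.pi * mellinPoint α ξ)
    (by simpa using hc) (by simpa using hsc)
  simp only [pi_mul_re, mellinPoint_re] at key
  constructor
  · rw [Real.cot_eq_cos_div_sin]
    exact le_norm_mellinMul α (cotSymbol h0 h1) (div_pos hc hs) (fun ξ => (key ξ).1) f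
  · rw [halfHilbert_apply]
    simpa using norm_mellinMul_le α (cotSymbol h0 h1) (C := 1) (fun ξ => (key ξ).2) f

end halfHilbert

/-! ### The logarithmic kernel -/

lemma locallyIntegrable_of_intervalIntegrable {f : ℝ → ℝ}
    (h : ∀ b : ℝ, 0 ≤ b → IntervalIntegrable f volume (-b) b) : LocallyIntegrable f := by
  rw [locallyIntegrable_iff]
  intro k hk
  obtain ⟨b, hb⟩ := hk.isBounded.subset_closedBall 0
  rw [Real.closedBall_eq_Icc, zero_sub, zero_add] at hb
  have hb' : k ⊆ Icc (-|b|) |b| :=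
    hb.trans (Icc_subset_Icc (neg_le_neg (le_abs_self b)) (le_abs_self b))
  have h2 := (intervalIntegrable_iff_integrableOn_Icc_of_le
    (by linarith [abs_nonneg b] : -|b| ≤ |b|)).1 (h |b| (abs_nonneg b))
  exact h2.mono_set hb'

lemma locallyIntegrable_log : LocallyIntegrable Real.log :=
  locallyIntegrable_of_intervalIntegrable fun _ _ => intervalIntegral.intervalIntegrable_log'

lemma locallyIntegrable_log_sq : LocallyIntegrable fun u : ℝ => Real.log u ^ 2 := by
  -- On `[0, ∞)` the continuous antiderivative `u log² u - 2 u log u + 2 u` is written in terms of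
  -- `√u log √u`.
  let P : ℝ → ℝ := fun u => 4 * (√u * Real.log √u) ^ 2 - 2 * (u * Real.log u) + 2 * u
  have hmul := Real.continuous_mul_log
  have hcont : Continuous P :=
    (((hmul.comp Real.continuous_sqrt).pow 2).const_mul 4 |>.sub (hmul.const_mul 2)).add
      (continuous_id.const_mul 2)
  have hP : ∀ u : ℝ, 0 ≤ u → P u = u * Real.log u * Real.log u - 2 * (u * Real.log u) + 2 * u := by
    intro u hu
    simp only [P]
    rw [Real.log_sqrt hu, mul_pow, Real.sq_sqrt hu]
    ring
  have hd : ∀ u : ℝ, 0 < u → HasDerivAt P (Real.log u ^ 2) u := by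
    intro u hu
    have h1 := Real.hasDerivAt_log hu.ne'
    have h2 : HasDerivAt (fun u => u * Real.log u) (1 * Real.log u + u * u⁻¹) u :=
      (hasDerivAt_id u).mul h1
    have h3 : HasDerivAt (fun u => u * Real.log u * Real.log u - 2 * (u * Real.log u) + 2 * u)
        ((1 * Real.log u + u * u⁻¹) * Real.log u + u * Real.log u * u⁻¹ -
          2 * (1 * Real.log u + u * u⁻¹) + 2 * 1) u :=
      ((h2.mul h1).sub (h2.const_mul 2)).add ((hasDerivAt_id u).const_mul 2)
    have h4 : HasDerivAt P _ u := h3.congr_of_eventuallyEq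
      ((eventually_gt_nhds hu).mono fun v hv => hP v (le_of_lt hv))
    convert! h4 using 1
    field_simp
    ring
  have hpos : ∀ b : ℝ, 0 ≤ b → IntervalIntegrable (fun u : ℝ => Real.log u ^ 2) volume 0 b := by
    intro b hb
    refine intervalIntegral.intervalIntegrable_deriv_of_nonneg hcont.continuousOn
      (fun u hu => hd u ?_) fun u _ => sq_nonneg _
    simp only [hb, inf_of_le_left, mem_Ioo] at hu
    exact hu.1
  refine locallyIntegrable_of_intervalIntegrable fun b hb => ?_
  refine IntervalIntegrable.trans (b := 0) ?_ (hpos b hb)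
  have h := ((hpos b hb).comp_sub_left 0).symm
  simpa [Real.log_neg_eq_log] using h

/-- Square integrability against the dual weight is what is needed for pairing a kernel with
elements of `L²(ℝ₊; x^(2α-1) dx)`. -/
lemma memLp_dual_of_integrableOn {α : ℝ} {κ : ℝ → ℝ} (hm : Measurable κ)
    (hi : IntegrableOn (fun t => t ^ (1 - 2 * α) * κ t ^ 2) (Ioi 0)) :
    MemLp (fun t => ((t ^ (1 - 2 * α) : ℝ) : ℂ) * (κ t : ℂ)) 2 (halfMeasure α) := by
  have hmeas : Measurable fun t : ℝ => ((t ^ (1 - 2 * α) : ℝ) : ℂ) * (κ t : ℂ) := by fun_prop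
  rw [memLp_two_iff_integrable_sq_norm hmeas.aestronglyMeasurable, halfMeasure,
    integrable_withDensity_iff_integrable_smul' (by fun_prop)
      (Eventually.of_forall fun x => ENNReal.ofReal_lt_top)]
  refine hi.congr_fun (fun t ht => ?_) measurableSet_Ioi
  have ht : 0 < t := ht
  simp only
  rw [ENNReal.toReal_ofReal (by positivity), norm_mul, Complex.norm_real, Complex.norm_real,
    Real.norm_of_nonneg (by positivity), mul_pow, Real.norm_eq_abs, sq_abs, smul_eq_mul, ← mul_assoc]
  congr 1
  rw [sq, ← mul_assoc, ← Real.rpow_add ht]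
  simp

lemma log_one_sub_div {y t : ℝ} (ht : 0 < t) (hne : t ≠ y) :
    Real.log |1 - y / t| = Real.log (y - t) - Real.log t := by
  have h : |1 - y / t| = |y - t| / |t| := by
    rw [← abs_div, ← abs_neg]; congr 1; field_simp; ring
  rw [h, Real.log_div (abs_ne_zero.2 (sub_ne_zero.2 hne.symm)) (abs_ne_zero.2 ht.ne'), Real.log_abs,
    Real.log_abs]

lemma memLp_dual_log {α : ℝ} (h0 : 0 < α) (h1 : α < 1 / 2) {y : ℝ} (hy : 0 < y) :
    MemLp (fun t => ((t ^ (1 - 2 * α) : ℝ) : ℂ) * (Real.log |1 - y / t| : ℂ)) 2 (halfMeasure α) := by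
  have hm : Measurable fun t : ℝ => Real.log |1 - y / t| := by
    refine Real.measurable_log.comp ?_
    exact (measurable_const.sub (measurable_const.div measurable_id)).abs
  refine memLp_dual_of_integrableOn hm ?_
  have hm2 : Measurable fun t : ℝ => t ^ (1 - 2 * α) * Real.log |1 - y / t| ^ 2 := by fun_prop
  have hpos : 0 ≤ 1 - 2 * α := by linarith
  rw [← Ioc_union_Ioi_eq_Ioi (by positivity : (0 : ℝ) ≤ 2 * y)]
  refine IntegrableOn.union ?_ ?_
  · have hsub : LocallyIntegrable fun t : ℝ => Real.log (y - t) ^ 2 := by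
      refine locallyIntegrable_of_intervalIntegrable fun b hb => ?_
      have hii : IntervalIntegrable (fun t : ℝ => Real.log t ^ 2) volume (y + b) (y - b) :=
        intervalIntegrable_iff.2 ((locallyIntegrable_log_sq.integrableOn_isCompact
          isCompact_uIcc).mono_set uIoc_subset_uIcc)
      simpa using hii.comp_sub_left y
    have hdom : IntegrableOn (fun t => (2 * y) ^ (1 - 2 * α) * 2 *
        (Real.log (y - t) ^ 2 + Real.log t ^ 2)) (Ioc 0 (2 * y)) :=
      (((hsub.integrableOn_isCompact isCompact_Icc).add
      (locallyIntegrable_log_sq.integrableOn_isCompact isCompact_Icc)).const_mul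
      ((2 * y) ^ (1 - 2 * α) * 2)).mono_measure (Measure.restrict_mono
        (Ioc_subset_Icc_self (a := 0) (b := 2 * y)) le_rfl)
    refine Integrable.mono' hdom hm2.aestronglyMeasurable ?_
    have hne : ∀ᵐ t : ℝ, t ≠ y := by simp [ae_iff, measure_singleton]
    filter_upwards [ae_restrict_mem measurableSet_Ioc, ae_restrict_of_ae hne] with t ht hty
    rw [Real.norm_of_nonneg (mul_nonneg (Real.rpow_nonneg ht.1.le _) (sq_nonneg _)),
      log_one_sub_div ht.1 hty, mul_assoc]
    refine mul_le_mul (Real.rpow_le_rpow ht.1.le ht.2 hpos) ?_ (sq_nonneg _) (by positivity)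
    nlinarith [sq_nonneg (Real.log (y - t) + Real.log t)]
  · have hdom := (integrableOn_Ioi_rpow_of_lt (a := -1 - 2 * α) (by linarith)
      (by positivity : (0 : ℝ) < 2 * y)).const_mul (4 * y ^ 2)
    refine Integrable.mono' hdom hm2.aestronglyMeasurable ?_
    filter_upwards [ae_restrict_mem measurableSet_Ioi] with t ht
    have ht : 2 * y < t := ht
    have ht0 : 0 < t := by linarith
    rw [Real.norm_of_nonneg (mul_nonneg (Real.rpow_nonneg ht0.le _) (sq_nonneg _))]
    have hv : y / t ≤ 1 / 2 := by rw [div_le_div_iff₀ ht0 two_pos]; linarith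
    have hv0 : 0 < y / t := by positivity
    have hlog : Real.log |1 - y / t| ^ 2 ≤ (2 * (y / t)) ^ 2 := by
      rw [abs_of_pos (by linarith)]
      have a1 := Real.one_sub_inv_le_log_of_pos (by linarith : 0 < 1 - y / t)
      have a2 := Real.log_nonpos (by linarith : 0 ≤ 1 - y / t) (by linarith)
      have a3 : (1 - y / t)⁻¹ ≤ 1 + 2 * (y / t) := by
        rw [inv_le_iff_one_le_mul₀ (by linarith)]
        nlinarith
      rw [sq_le_sq, abs_of_nonpos a2, abs_of_pos (by positivity)]
      linarith
    calc t ^ (1 - 2 * α) * Real.log |1 - y / t| ^ 2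
        ≤ t ^ (1 - 2 * α) * (2 * (y / t)) ^ 2 := by gcongr
      _ = 4 * y ^ 2 * t ^ (-1 - 2 * α) := by
        have : t ^ (1 - 2 * α) = t ^ (-1 - 2 * α) * t ^ (2 : ℕ) := by
          rw [← Real.rpow_natCast, ← Real.rpow_add ht0]; congr 1; push_cast; ring
        rw [this]; field_simp; ring

lemma memLp_dual_indicator {α : ℝ} (h1 : α < 1 / 2) (y : ℝ) :
    MemLp (fun t => ((t ^ (1 - 2 * α) : ℝ) : ℂ) * (((Ioc 0 y).indicator (fun _ => 1) t : ℝ) : ℂ)) 2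
      (halfMeasure α) := by
  refine memLp_dual_of_integrableOn (measurable_const.indicator measurableSet_Ioc) ?_
  have h : IntegrableOn (fun t : ℝ => t ^ (1 - 2 * α)) (Ioc 0 y) :=
    ((Real.continuous_rpow_const (by linarith)).integrableOn_Icc (a := 0) (b := y)).mono_set
      Ioc_subset_Icc_self
  have h2 : (fun t : ℝ => t ^ (1 - 2 * α) * (Ioc 0 y).indicator (fun _ => (1 : ℝ)) t ^ 2) =
      (Ioc 0 y).indicator fun t => t ^ (1 - 2 * α) := by
    funext t
    by_cases ht : t ∈ Ioc 0 y <;> simp [ht]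
  rw [h2]
  exact (h.integrable_indicator measurableSet_Ioc).integrableOn

lemma integral_indicator_mul {y : ℝ} (hy : 0 ≤ y) (g : ℝ → ℂ) :
    ∫ t in Ioi 0, (((Ioc 0 y).indicator (fun _ => 1) t : ℝ) : ℂ) * g t = ∫ t in (0)..y, g t := by
  have h2 : (fun t : ℝ => (((Ioc 0 y).indicator (fun _ => 1) t : ℝ) : ℂ) * g t) =
      (Ioc 0 y).indicator g := by
    funext t
    by_cases ht : t ∈ Ioc 0 y <;> simp [ht]
  rw [h2, integral_indicator measurableSet_Ioc, Measure.restrict_restrict measurableSet_Ioc,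
    inter_eq_self_of_subset_left Ioc_subset_Ioi_self, intervalIntegral.integral_of_le hy]

lemma integrableOn_Ioc_of_Lp {α : ℝ} (h1 : α < 1 / 2) (f : Lp ℂ 2 (halfMeasure α)) (y : ℝ) :
    IntegrableOn f (Ioc 0 y) := by
  have h := integrableOn_mul_of_memLp (memLp_dual_indicator h1 y) f
  refine (h.mono_set Ioc_subset_Ioi_self).congr_fun (fun t ht => ?_) measurableSet_Ioc
  simp [ht]

/-! ### Principal values of smooth functions -/

lemma locallyIntegrable_log_complex : LocallyIntegrable fun u : ℝ => (Real.log u : ℂ) := fun u => by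
  obtain ⟨s, hs, hi⟩ := locallyIntegrable_log u
  exact ⟨s, hs, hi.ofReal⟩

section smooth

variable {φ : ℝ → ℂ}

lemma integrable_mul_log {ψ : ℝ → ℂ} (hψ : Continuous ψ) (hc : HasCompactSupport ψ) (x : ℝ) :
    Integrable fun t => ψ t * (Real.log (t - x) : ℂ) := by
  have h := locallyIntegrable_log_complex.integrable_smul_left_of_hasCompactSupport
    (g := fun u => ψ (u + x)) (by fun_prop)
    (hc.comp_homeomorph (Homeomorph.addRight x))
  simpa using h.comp_sub_right x

lemma tendsto_mul_log_symm (hφ : ContDiff ℝ 1 φ) (x : ℝ) :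
    Tendsto (fun ε : ℝ => (φ (x + ε) - φ (x - ε)) * (Real.log ε : ℂ)) (𝓝[>] 0) (𝓝 0) := by
  have hd : HasDerivAt φ (deriv φ x) x := (hφ.differentiable one_ne_zero x).hasDerivAt
  have h1 : HasDerivAt (fun ε : ℝ => φ (x + ε)) (deriv φ x) 0 :=
    HasDerivAt.comp_const_add x 0 (by simpa using hd)
  have h2 : HasDerivAt (fun ε : ℝ => φ (x - ε)) (-deriv φ x) 0 :=
    HasDerivAt.comp_const_sub x 0 (by simpa using hd)
  have h3 := (h1.sub h2).tendsto_slope_zero_right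
  have h4 : Tendsto (fun ε : ℝ => ((ε * Real.log ε : ℝ) : ℂ)) (𝓝[>] 0) (𝓝 0) := by
    have : Continuous fun ε : ℝ => ((ε * Real.log ε : ℝ) : ℂ) :=
      Complex.continuous_ofReal.comp Real.continuous_mul_log
    exact (this.tendsto' 0 0 (by simp)).mono_left nhdsWithin_le_nhds
  have h5 := h3.mul h4
  rw [mul_zero] at h5
  refine h5.congr' ?_
  filter_upwards [self_mem_nhdsWithin] with ε hε
  have hε : (ε : ℂ) ≠ 0 := by exact_mod_cast (ne_of_gt hε)
  simp only [Pi.sub_apply, zero_add, Complex.real_smul]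
  push_cast
  simp
  field_simp

lemma setIntegral_truncation_eq (hs : tsupport φ ⊆ Ioi 0) (x ε : ℝ) :
    ∫ t in {t : ℝ | 0 < t ∧ ε < |t - x|}, φ t / ((t - x : ℝ) : ℂ) =
      ∫ t in {t : ℝ | ε < |t - x|}, φ t / ((t - x : ℝ) : ℂ) := by
  symm
  refine setIntegral_eq_of_subset_of_forall_sdiff_eq_zero
    (isOpen_lt continuous_const (by fun_prop)).measurableSet (fun t ht => ht.2) fun t ht => ?_
  have : φ t = 0 := by
    by_contra h
    exact ht.2 ⟨hs (subset_tsupport _ h), ht.1⟩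
  simp [this]

lemma integrableOn_truncation (hφ : Continuous φ) (hc : HasCompactSupport φ) (x : ℝ) {ε : ℝ}
    (hε : 0 < ε) : IntegrableOn (fun t => φ t / ((t - x : ℝ) : ℂ)) {t : ℝ | ε < |t - x|} := by
  have hm : MeasurableSet {t : ℝ | ε < |t - x|} :=
    (isOpen_lt continuous_const (by fun_prop)).measurableSet
  refine Integrable.mono' ((hφ.integrable_of_hasCompactSupport hc).norm.const_mul ε⁻¹).integrableOn
    ?_ ?_
  · exact (hφ.measurable.div (by fun_prop)).aestronglyMeasurable
  · filter_upwards [ae_restrict_mem hm] with t ht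
    have ht : ε < |t - x| := ht
    rw [norm_div, Complex.norm_real, Real.norm_eq_abs, div_eq_mul_inv, mul_comm]
    gcongr

lemma setOf_lt_abs_sub (x : ℝ) (ε : ℝ) : {t : ℝ | ε < |t - x|} = Ioi (x + ε) ∪ Iio (x - ε) := by
  ext t
  simp only [mem_ofPred_eq, lt_abs, mem_union, mem_Ioi, mem_Iio]
  constructor <;> rintro (h | h)
  · left; linarith
  · right; linarith
  · left; linarith
  · right; linarith

/-- Integration by parts in the truncated Hilbert transform. -/
lemma integral_truncation_eq (hφ : ContDiff ℝ 1 φ) (hc : HasCompactSupport φ) (x : ℝ) {ε : ℝ}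
    (hε : 0 < ε) :
    ∫ t in {t : ℝ | ε < |t - x|}, φ t / ((t - x : ℝ) : ℂ) =
      -(∫ t in {t : ℝ | ε < |t - x|}, deriv φ t * (Real.log (t - x) : ℂ)) -
        (φ (x + ε) - φ (x - ε)) * (Real.log ε : ℂ) := by
  have hdc : Continuous (deriv φ) := hφ.continuous_deriv le_rfl
  have hi1 := integrableOn_truncation hφ.continuous hc x hε
  have hi2 := (integrable_mul_log hdc hc.deriv x).integrableOn (s := {t : ℝ | ε < |t - x|})
  have hi : IntegrableOn (fun t => deriv φ t * (Real.log (t - x) : ℂ) + φ t / ((t - x : ℝ) : ℂ))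
      {t : ℝ | ε < |t - x|} := hi2.add hi1
  have hd : ∀ t, t ≠ x → HasDerivAt (fun t => φ t * (Real.log (t - x) : ℂ))
      (deriv φ t * (Real.log (t - x) : ℂ) + φ t / ((t - x : ℝ) : ℂ)) t := by
    intro t ht
    have h1 : HasDerivAt φ (deriv φ t) t := (hφ.differentiable one_ne_zero t).hasDerivAt
    have h2 : HasDerivAt (fun t => Real.log (t - x)) (t - x)⁻¹ t :=
      HasDerivAt.comp_sub_const t x (Real.hasDerivAt_log (sub_ne_zero.2 ht))
    have h3 := h1.mul h2.ofReal_comp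
    rw [Complex.ofReal_inv] at h3
    exact h3
  rw [setOf_lt_abs_sub] at hi hi1 hi2 ⊢
  have hzero : ∀ᶠ t in cocompact ℝ, φ t = 0 := by
    filter_upwards [hc.compl_mem_cocompact] with t ht
    exact image_eq_zero_of_notMem_tsupport ht
  have htop : Tendsto (fun t => φ t * (Real.log (t - x) : ℂ)) atTop (𝓝 0) := by
    refine tendsto_const_nhds.congr' (Filter.EventuallyEq.symm ?_)
    exact (hzero.filter_mono atTop_le_cocompact).mono fun t ht => by simp [ht]
  have hbot : Tendsto (fun t => φ t * (Real.log (t - x) : ℂ)) atBot (𝓝 0) := by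
    refine tendsto_const_nhds.congr' (Filter.EventuallyEq.symm ?_)
    exact (hzero.filter_mono atBot_le_cocompact).mono fun t ht => by simp [ht]
  have hR := integral_Ioi_of_hasDerivAt_of_tendsto' (a := x + ε)
    (fun t ht => hd t (by have : x + ε ≤ t := ht; linarith)) (hi.mono_set subset_union_left) htop
  have hL := integral_Iic_of_hasDerivAt_of_tendsto' (a := x - ε)
    (fun t ht => hd t (by have : t ≤ x - ε := ht; linarith))
    (integrableOn_Iic_iff_integrableOn_Iio (by finiteness) |>.2 (hi.mono_set subset_union_right)) hbot
  rw [integral_Iic_eq_integral_Iio] at hL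
  have hdisj : Disjoint (Ioi (x + ε)) (Iio (x - ε)) := by
    rw [Set.disjoint_left]; intro t h1 h2
    have h1 : x + ε < t := h1
    have h2 : t < x - ε := h2
    linarith
  have hsum : ∫ t in Ioi (x + ε) ∪ Iio (x - ε),
      (deriv φ t * (Real.log (t - x) : ℂ) + φ t / ((t - x : ℝ) : ℂ)) =
      -(φ (x + ε) - φ (x - ε)) * (Real.log ε : ℂ) := by
    rw [setIntegral_union hdisj measurableSet_Iio (hi.mono_set subset_union_left)
      (hi.mono_set subset_union_right), hR, hL]
    have e1 : x + ε - x = ε := by ring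
    have e2 : x - ε - x = -ε := by ring
    rw [e1, e2, Real.log_neg_eq_log]
    ring
  rw [integral_add hi2 hi1] at hsum
  linear_combination hsum

/-- The principal value of a `C¹` function with compact support in `(0, ∞)` exists everywhere. -/
lemma hasHalfHilbertAt_of_contDiff (hφ : ContDiff ℝ 1 φ) (hc : HasCompactSupport φ)
    (hs : tsupport φ ⊆ Ioi 0) (x : ℝ) :
    HasHalfHilbertAt φ x
      (-(1 / (Real.pi : ℂ)) * ∫ t, deriv φ t * (Real.log (t - x) : ℂ)) := by
  have hdc : Continuous (deriv φ) := hφ.continuous_deriv le_rfl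
  have hi := integrable_mul_log hdc hc.deriv x
  refine ⟨fun ε hε => (integrableOn_truncation hφ.continuous hc x hε).mono_set fun t ht => ht.2, ?_⟩
  have hlim : Tendsto (fun ε : ℝ => ∫ t in {t : ℝ | ε < |t - x|}, deriv φ t * (Real.log (t - x) : ℂ))
      (𝓝[>] 0) (𝓝 (∫ t, deriv φ t * (Real.log (t - x) : ℂ))) := by
    have hm : ∀ ε, MeasurableSet {t : ℝ | ε < |t - x|} := fun ε =>
      (isOpen_lt continuous_const (by fun_prop)).measurableSet
    simp_rw [← integral_indicator (hm _)]
    refine tendsto_integral_filter_of_dominated_convergence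
      (fun t => ‖deriv φ t * (Real.log (t - x) : ℂ)‖) (Eventually.of_forall fun ε =>
        hi.aestronglyMeasurable.indicator (hm ε)) (Eventually.of_forall fun ε =>
        Eventually.of_forall fun t => norm_indicator_le_norm_self _ _) hi.norm ?_
    have hne : ∀ᵐ t : ℝ, t ≠ x := by simp [ae_iff, measure_singleton]
    filter_upwards [hne] with t ht
    refine tendsto_const_nhds.congr' ?_
    filter_upwards [Ioo_mem_nhdsGT (abs_pos.2 (sub_ne_zero.2 ht))] with ε hε
    rw [indicator_of_mem (show t ∈ {t : ℝ | ε < |t - x|} from hε.2)]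
  have h2 := ((hlim.neg.sub (tendsto_mul_log_symm hφ x)).const_mul (1 / (Real.pi : ℂ)))
  rw [sub_zero, mul_neg, ← neg_mul] at h2
  refine h2.congr' ?_
  filter_upwards [self_mem_nhdsWithin] with ε hε
  rw [setIntegral_truncation_eq hs, integral_truncation_eq hφ hc x hε]

/-- The logarithmic potential of a `C¹` function with compact support in `(0, ∞)`. -/
lemma integral_log_mul_eq_convolution (hs : tsupport φ ⊆ Ioi 0) (hφ : Continuous φ)
    (hc : HasCompactSupport φ) (y : ℝ) :
    ∫ t in Ioi (0 : ℝ), (Real.log |1 - y / t| : ℂ) * φ t =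
      (φ ⋆[ContinuousLinearMap.mul ℝ ℂ] fun u : ℝ => (Real.log u : ℂ)) y -
        ∫ t, φ t * (Real.log t : ℂ) := by
  have hi1 := integrable_mul_log hφ hc y
  have hi2 := integrable_mul_log hφ hc 0
  simp only [sub_zero] at hi2
  have hz : ∀ t, t ∉ Ioi (0 : ℝ) → (Real.log |1 - y / t| : ℂ) * φ t = 0 := fun t ht => by
    have : φ t = 0 := by
      by_contra h
      exact ht (hs (subset_tsupport _ h))
    rw [this, mul_zero]
  have hflip : ∀ t, Real.log (t - y) = Real.log (y - t) := fun t => by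
    rw [← Real.log_neg_eq_log, neg_sub]
  simp only [hflip] at hi1
  rw [setIntegral_eq_integral_of_forall_compl_eq_zero hz, convolution_def]
  simp only [ContinuousLinearMap.mul_apply']
  rw [← integral_sub hi1 hi2]
  have hne : ∀ᵐ t : ℝ, t ≠ y := by simp [ae_iff, measure_singleton]
  refine integral_congr_ae ?_
  filter_upwards [hne] with t ht
  by_cases h0 : 0 < t
  · rw [log_one_sub_div h0 ht]; push_cast; ring
  · have : φ t = 0 := by
      by_contra h
      exact h0 (hs (subset_tsupport _ h))
    simp [this]

lemma hasDerivAt_logPotential (hφ : ContDiff ℝ 1 φ) (hc : HasCompactSupport φ)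
    (hs : tsupport φ ⊆ Ioi 0) (y : ℝ) :
    HasDerivAt (fun y : ℝ => ∫ t in Ioi (0 : ℝ), (Real.log |1 - y / t| : ℂ) * φ t)
      (∫ t, deriv φ t * (Real.log (t - y) : ℂ)) y := by
  have h := (hc.hasDerivAt_convolution_left (ContinuousLinearMap.mul ℝ ℂ) hφ
    locallyIntegrable_log_complex y).sub_const (∫ t, φ t * (Real.log t : ℂ))
  have e : (deriv φ ⋆[ContinuousLinearMap.mul ℝ ℂ] fun u : ℝ => (Real.log u : ℂ)) y =
      ∫ t, deriv φ t * (Real.log (t - y) : ℂ) := by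
    rw [convolution_def]
    refine integral_congr_ae (Eventually.of_forall fun t => ?_)
    simp only [ContinuousLinearMap.mul_apply']
    rw [← Real.log_neg_eq_log, neg_sub]
  rw [e] at h
  refine h.congr_of_eventuallyEq (Eventually.of_forall fun z => ?_)
  exact integral_log_mul_eq_convolution hs hφ.continuous hc z

lemma continuous_integral_deriv_mul_log (hφ : ContDiff ℝ 1 φ) (hc : HasCompactSupport φ) :
    Continuous fun y : ℝ => ∫ t, deriv φ t * (Real.log (t - y) : ℂ) := by
  have h := hc.deriv.continuous_convolution_left (ContinuousLinearMap.mul ℝ ℂ)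
    (hφ.continuous_deriv le_rfl) locallyIntegrable_log_complex
  refine h.congr fun y => ?_
  rw [convolution_def]
  refine integral_congr_ae (Eventually.of_forall fun t => ?_)
  simp only [ContinuousLinearMap.mul_apply']
  rw [← Real.log_neg_eq_log, neg_sub]

end smooth

/-! ### Density of smooth functions -/

section dense

variable {α : ℝ}

lemma memLp_of_tsupport_subset {φ : ℝ → ℂ} (hφ : Continuous φ) (hc : HasCompactSupport φ)
    (hs : tsupport φ ⊆ Ioi 0) : MemLp φ 2 (halfMeasure α) := by
  rw [memLp_two_halfMeasure_iff]
  have hcont : Continuous fun s : ℝ => (Real.exp (α * s) : ℂ) * φ (Real.exp s) := by fun_prop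
  refine hcont.memLp_of_hasCompactSupport ?_
  have hK : IsCompact (Real.log '' tsupport φ) :=
    hc.isCompact.image_of_continuousOn (Real.continuousOn_log.mono fun x hx => (ne_of_gt (hs hx)))
  refine HasCompactSupport.intro hK fun s hs' => ?_
  have : φ (Real.exp s) = 0 := by
    by_contra h
    exact hs' ⟨Real.exp s, subset_tsupport _ h, Real.log_exp s⟩
  rw [this, mul_zero]

/-- Transport of a smooth compactly supported function on the line to the half line. -/
lemma exists_isCcThree_of_contDiff {ψ : ℝ → ℂ} (hψ : ContDiff ℝ ∞ ψ) (hc : HasCompactSupport ψ) :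
    ∃ φ : ℝ → ℂ, IsCcThree φ ∧ ∀ s : ℝ, (Real.exp (α * s) : ℂ) * φ (Real.exp s) = ψ s := by
  let φ : ℝ → ℂ := fun x =>
    if 0 < x then (Real.exp (-(α * Real.log x)) : ℂ) * ψ (Real.log x) else 0
  have hK : IsCompact (Real.exp '' tsupport ψ) := hc.isCompact.image Real.continuous_exp
  have hKpos : Real.exp '' tsupport ψ ⊆ Ioi 0 := by
    rintro _ ⟨s, -, rfl⟩; exact Real.exp_pos s
  have hzero : ∀ x, x ∉ Real.exp '' tsupport ψ → φ x = 0 := by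
    intro x hx
    by_cases h : 0 < x
    · have : ψ (Real.log x) = 0 := by
        by_contra h2
        exact hx ⟨Real.log x, subset_tsupport _ h2, Real.exp_log h⟩
      simp [φ, this]
    · simp [φ, h]
  have hts : tsupport φ ⊆ Real.exp '' tsupport ψ :=
    closure_minimal (fun x hx => by by_contra h; exact hx (hzero x h)) hK.isClosed
  refine ⟨φ, ⟨?_, HasCompactSupport.intro hK hzero, hts.trans hKpos⟩, fun s => ?_⟩
  · rw [contDiff_iff_contDiffAt]
    intro x
    by_cases hx : 0 < x
    · have hlog : ContDiffAt ℝ 3 Real.log x := Real.contDiffAt_log.2 hx.ne'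
      have h1 : ContDiffAt ℝ 3 (fun x => (Real.exp (-(α * Real.log x)) : ℂ)) x :=
        Complex.ofRealCLM.contDiff.contDiffAt.comp x
          (Real.contDiff_exp.contDiffAt.comp x (contDiffAt_const.mul hlog).neg)
      have h2 : ContDiffAt ℝ 3 (fun x => ψ (Real.log x)) x :=
        (contDiff_infty.1 hψ 3).contDiffAt.comp x hlog
      refine (h1.mul h2).congr_of_eventuallyEq ?_
      filter_upwards [eventually_gt_nhds hx] with y hy
      simp [φ, hy]
    · have hx' : x ∉ Real.exp '' tsupport ψ := fun h => hx (hKpos h)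
      refine (contDiffAt_const (c := (0 : ℂ))).congr_of_eventuallyEq ?_
      filter_upwards [hK.isClosed.isOpen_compl.mem_nhds hx'] with y hy
      exact hzero y hy
  · simp only [φ, Real.exp_pos, if_true, Real.log_exp]
    rw [← mul_assoc, ← Complex.ofReal_mul, ← Real.exp_add]
    simp

lemma dense_isCcThree (α : ℝ) : Dense {f : Lp ℂ 2 (halfMeasure α) |
    ∃ (φ : ℝ → ℂ) (hφ : MemLp φ 2 (halfMeasure α)), IsCcThree φ ∧ f = hφ.toLp φ} := by
  have h := (Lp.dense_hasCompactSupport_contDiff (E := ℝ) (F := ℂ) (μ := volume) (p := 2)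
    ENNReal.ofNat_ne_top)
  have h2 := h.preimage (logCoord α).toHomeomorph.isOpenMap
  refine h2.mono ?_
  rintro f ⟨ψ, hfψ, hc, hψ⟩
  obtain ⟨φ, hφ, hφψ⟩ := exists_isCcThree_of_contDiff (α := α) hψ hc
  have hmem : MemLp φ 2 (halfMeasure α) :=
    memLp_of_tsupport_subset hφ.contDiff.continuous hφ.hasCompactSupport hφ.tsupport_subset
  refine ⟨φ, hmem, hφ, (logCoord α).injective ?_⟩
  ext1
  have h3 : (logCoord α f : ℝ → ℂ) =ᵐ[volume] ψ := hfψ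
  filter_upwards [h3, coeFn_logCoord α (hmem.toLp φ), ae_halfMeasure_iff_ae_exp.1 hmem.coeFn_toLp]
    with s e1 e2 e3
  rw [e1, e2, e3, hφψ]

end dense

lemma HasHalfHilbertAt.congr_ae {f₁ f₂ : ℝ → ℂ} (h : f₁ =ᵐ[volume.restrict (Ioi (0 : ℝ))] f₂)
    {x : ℝ} {y : ℂ} (hf : HasHalfHilbertAt f₁ x y) : HasHalfHilbertAt f₂ x y := by
  have key : ∀ ε : ℝ, (fun t => f₁ t / ((t - x : ℝ) : ℂ))
      =ᵐ[volume.restrict {t : ℝ | 0 < t ∧ ε < |t - x|}] fun t => f₂ t / ((t - x : ℝ) : ℂ) := by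
    intro ε
    filter_upwards [ae_restrict_of_ae_restrict_of_subset
      (show {t : ℝ | 0 < t ∧ ε < |t - x|} ⊆ Ioi 0 from fun t ht => ht.1) h] with t ht
    rw [ht]
  refine ⟨fun ε hε => (hf.1 ε hε).congr (key ε), hf.2.congr fun ε => ?_⟩
  rw [integral_congr_ae (key ε)]

section representation

variable {α : ℝ} (h0 : 0 < α) (h1 : α < 1 / 2)

/-- The principal value computes the half-Hilbert transform of the class of a given function. -/
lemma halfHilbert_toLp_ae_eq {φ g : ℝ → ℂ} (hφ : MemLp φ 2 (halfMeasure α))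
    (h : HasHalfHilbert φ g) :
    ∀ᵐ x ∂(volume.restrict (Ioi (0 : ℝ))), halfHilbert h0 h1 (hφ.toLp φ) x = g x := by
  refine halfHilbert_ae_eq_of_hasHalfHilbert h0 h1 _ _ ?_
  filter_upwards [h] with x hx
  exact hx.congr_ae (ae_restrict_Ioi_iff_ae_halfMeasure.2 hφ.coeFn_toLp.symm)

/-- The integrated form of the representation of `h = H f`, on smooth functions. -/
lemma integral_log_eq_integral_halfHilbert_of_isCcThree {φ : ℝ → ℂ}
    (hφ : MemLp φ 2 (halfMeasure α)) (hcc : IsCcThree φ) {y : ℝ} (hy : 0 ≤ y) :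
    -(1 / (Real.pi : ℂ)) * ∫ t in Ioi (0 : ℝ), (Real.log |1 - y / t| : ℂ) * (hφ.toLp φ) t =
      ∫ t in (0)..y, halfHilbert h0 h1 (hφ.toLp φ) t := by
  have hd1 : ContDiff ℝ 1 φ := hcc.contDiff.of_le (by norm_num)
  have hc := hcc.hasCompactSupport
  have hs := hcc.tsupport_subset
  have hpv := halfHilbert_toLp_ae_eq h0 h1 hφ
    (g := fun x => -(1 / (Real.pi : ℂ)) * ∫ t, deriv φ t * (Real.log (t - x) : ℂ))
    (Eventually.of_forall fun x => hasHalfHilbertAt_of_contDiff hd1 hc hs x)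
  have e1 : ∫ t in (0)..y, halfHilbert h0 h1 (hφ.toLp φ) t =
      ∫ x in (0)..y, -(1 / (Real.pi : ℂ)) * ∫ t, deriv φ t * (Real.log (t - x) : ℂ) := by
    rw [intervalIntegral.integral_of_le hy, intervalIntegral.integral_of_le hy]
    exact integral_congr_ae (ae_restrict_of_ae_restrict_of_subset Ioc_subset_Ioi_self hpv)
  have e2 := intervalIntegral.integral_eq_sub_of_hasDerivAt (a := 0) (b := y)
    (fun x _ => hasDerivAt_logPotential hd1 hc hs x)
    ((continuous_integral_deriv_mul_log hd1 hc).intervalIntegrable _ _)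
  have e3 : ∫ t in Ioi (0 : ℝ), (Real.log |1 - y / t| : ℂ) * (hφ.toLp φ) t =
      ∫ t in Ioi (0 : ℝ), (Real.log |1 - y / t| : ℂ) * φ t := by
    refine integral_congr_ae ?_
    filter_upwards [ae_restrict_Ioi_iff_ae_halfMeasure.2 hφ.coeFn_toLp] with t ht
    rw [ht]
  rw [e1, intervalIntegral.integral_const_mul, e2, e3]
  simp

/-- The integrated form of the representation of `h = H f`, which extends from smooth functions since
both sides depend continuously on `f`. -/
lemma integral_log_eq_integral_halfHilbert (f : Lp ℂ 2 (halfMeasure α)) {y : ℝ} (hy : 0 < y) :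
    -(1 / (Real.pi : ℂ)) * ∫ t in Ioi (0 : ℝ), (Real.log |1 - y / t| : ℂ) * f t =
      ∫ t in (0)..y, halfHilbert h0 h1 f t := by
  have hcl : IsClosed {f : Lp ℂ 2 (halfMeasure α) |
      -(1 / (Real.pi : ℂ)) * ∫ t in Ioi (0 : ℝ), (Real.log |1 - y / t| : ℂ) * f t =
      ∫ t in (0)..y, halfHilbert h0 h1 f t} := by
    refine isClosed_eq ((continuous_integral_mul_of_memLp (memLp_dual_log h0 h1 hy)).const_mul _) ?_
    have h := (continuous_integral_mul_of_memLp (memLp_dual_indicator h1 y)).comp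
      (halfHilbert h0 h1).continuous
    refine h.congr fun f => ?_
    exact integral_indicator_mul hy.le _
  refine hcl.closure_subset_iff.2 ?_ ((dense_isCcThree α) f)
  rintro _ ⟨φ, hφ, hcc, rfl⟩
  exact integral_log_eq_integral_halfHilbert_of_isCcThree h0 h1 hφ hcc hy.le

lemma hasDerivAt_integral_log (f : Lp ℂ 2 (halfMeasure α)) :
    ∀ᵐ x ∂(volume.restrict (Ioi (0 : ℝ))),
      HasDerivAt (fun y : ℝ => -(1 / (Real.pi : ℂ)) *
        ∫ t in Ioi (0 : ℝ), (Real.log |1 - y / t| : ℂ) * f t) (halfHilbert h0 h1 f x) x := by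
  have hloc : LocallyIntegrable ((Ioi (0 : ℝ)).indicator (halfHilbert h0 h1 f)) := by
    rw [locallyIntegrable_iff]
    intro k hk
    obtain ⟨b, hb⟩ := hk.bddAbove
    rw [IntegrableOn, integrable_indicator_iff measurableSet_Ioi, IntegrableOn,
      Measure.restrict_restrict measurableSet_Ioi]
    exact (integrableOn_Ioc_of_Lp h1 (halfHilbert h0 h1 f) b).mono_set fun t ht =>
      ⟨ht.1, hb ht.2⟩
  filter_upwards [ae_restrict_of_ae (_root_.LocallyIntegrable.ae_hasDerivAt_integral hloc),
    ae_restrict_mem measurableSet_Ioi]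
    with x hx hx0
  have h := hx 0
  rw [indicator_of_mem hx0] at h
  refine h.congr_of_eventuallyEq ?_
  filter_upwards [eventually_gt_nhds hx0] with y hy
  rw [integral_log_eq_integral_halfHilbert h0 h1 f hy, intervalIntegral.integral_of_le hy.le,
    intervalIntegral.integral_of_le hy.le]
  exact setIntegral_congr_fun measurableSet_Ioc fun t ht => (indicator_of_mem ht.1 _).symm

end representation

/-! ### The half-Hilbert transform on the weighted space -/

theorem theorem1 (α : ℝ) (hα0 : 0 < α) (hα1 : α < 1 / 2) :
    -- the principal value transform is everywhere defined on the class `C_c^3`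
    (∀ φ : ℝ → ℂ, IsCcThree φ →
      MemLp φ 2 (halfMeasure α) ∧ ∀ x : ℝ, 0 < x → ∃ y : ℂ, HasHalfHilbertAt φ x y) ∧
    -- bounded operator with bounded inverse
    ∃ H : Lp ℂ 2 (halfMeasure α) ≃L[ℂ] Lp ℂ 2 (halfMeasure α),
      -- it extends the principal value transform
      (∀ (f : Lp ℂ 2 (halfMeasure α)) (g : ℝ → ℂ), HasHalfHilbert f g →
        ∀ᵐ x ∂(volume.restrict (Ioi (0 : ℝ))), H f x = g x) ∧
      -- it is the only bounded extension from `C_c^3`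
      (∀ T : Lp ℂ 2 (halfMeasure α) →L[ℂ] Lp ℂ 2 (halfMeasure α),
        (∀ (φ g : ℝ → ℂ) (hφ : MemLp φ 2 (halfMeasure α)), IsCcThree φ → HasHalfHilbert φ g →
          ∀ᵐ x ∂(volume.restrict (Ioi (0 : ℝ))), T (hφ.toLp φ) x = g x) →
        T = (H : Lp ℂ 2 (halfMeasure α) →L[ℂ] Lp ℂ 2 (halfMeasure α))) ∧
      -- the representation of `h = H f`
      (∀ f : Lp ℂ 2 (halfMeasure α),
        (∀ x : ℝ, 0 < x →
          IntegrableOn (fun t : ℝ => (Real.log |1 - x / t| : ℂ) * f t) (Ioi (0 : ℝ))) ∧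
        ∀ᵐ x ∂(volume.restrict (Ioi (0 : ℝ))),
          HasDerivAt
            (fun y : ℝ => -(1 / (Real.pi : ℂ)) *
              ∫ t in Ioi (0 : ℝ), (Real.log |1 - y / t| : ℂ) * f t)
            (H f x) x) ∧
      -- the inversion formula, with `h = H f`
      (∀ f : Lp ℂ 2 (halfMeasure α),
        (∀ x : ℝ, 0 < x →
          IntegrableOn (fun t : ℝ => H f t / (((√x + √t) * √t : ℝ) : ℂ)) (Ioi (0 : ℝ))) ∧
        ∀ᵐ x ∂(volume.restrict (Ioi (0 : ℝ))),
          f x = (1 / (Real.pi : ℂ)) *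
              (∫ t in Ioi (0 : ℝ), H f t / (((√x + √t) * √t : ℝ) : ℂ)) - H (H f) x) ∧
      -- the norm inequalities
      (α ≤ 1 / 4 → ∀ f : Lp ℂ 2 (halfMeasure α),
        ‖f‖ ≤ ‖H f‖ ∧ ‖H f‖ ≤ Real.cot (Real.pi * α) * ‖f‖) ∧
      (1 / 4 ≤ α → ∀ f : Lp ℂ 2 (halfMeasure α),
        Real.cot (Real.pi * α) * ‖f‖ ≤ ‖H f‖ ∧ ‖H f‖ ≤ ‖f‖) := by
  refine ⟨fun φ hφ => ⟨memLp_of_tsupport_subset hφ.contDiff.continuous hφ.hasCompactSupport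
    hφ.tsupport_subset, fun x _ => ⟨_, hasHalfHilbertAt_of_contDiff
      (hφ.contDiff.of_le (by norm_num)) hφ.hasCompactSupport hφ.tsupport_subset x⟩⟩,
    halfHilbert hα0 hα1, halfHilbert_ae_eq_of_hasHalfHilbert hα0 hα1, fun T hT => ?_,
    fun f => ⟨fun x hx => integrableOn_mul_of_memLp (memLp_dual_log hα0 hα1 hx) f,
      hasDerivAt_integral_log hα0 hα1 f⟩,
    fun f => ⟨fun x hx => integrableOn_sqrt_kernel hα0 hα1 _ hx,
      halfHilbert_inversion hα0 hα1 f⟩,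
    fun hα f => norm_halfHilbert_of_le hα0 hα1 hα f,
    fun hα f => norm_halfHilbert_of_ge hα0 hα1 hα f⟩
  refine DFunLike.coe_injective (T.continuous.ext_on (dense_isCcThree α)
    (ContinuousLinearMap.continuous _) ?_)
  rintro _ ⟨φ, hφ, hcc, rfl⟩
  have hg : HasHalfHilbert φ _ := Eventually.of_forall fun x => hasHalfHilbertAt_of_contDiff
    (hcc.contDiff.of_le (by norm_num)) hcc.hasCompactSupport hcc.tsupport_subset x
  refine Lp.ext (ae_restrict_Ioi_iff_ae_halfMeasure.1 ?_)
  filter_upwards [hT φ _ hφ hcc hg, halfHilbert_toLp_ae_eq hα0 hα1 hφ hg] with x h1 h2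
  exact h1.trans h2.symm
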